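/- Let $\mathbb S=\{0,1,-1\}$ be the hyperfield of signs and $\mathbb{TR}=\mathbb S\rtimes\mathbb R$ the tropical real hyperfield, whose elements are $\infty$ (its zero) and $ht^{\gamma}$ with $h\in\{\pm1\}$, $\gamma\in\mathbb R$. Write $\mathrm{ac}(ht^{\gamma})=h$, $\mathrm{ac}(\infty)=0$, and $\nu(ht^{\gamma})=\gamma$, $\nu(\infty)=\infty$; $\mathrm{ac}$ is applied to polynomials coefficientwise. For a hyperfield $H$, $f\in g\cdot l$ in $H[x_1,\dots,x_n]$ means that each coefficient of $f$ lies in the corresponding hypersum $\boxplus_{\bm n+\bm p=\bm m}\, b_{\bm n}c_{\bm p}$ of products of coefficients of $g$ and $l$. For nonempty sets $\mathcal F,\mathcal L\subseteq H[\bm x]$ with bounded degree on $\mathcal F$, put $(\mathcal F:\mathcal L)=\{g : (g\cdot l)\cap\mathcal F\ne\emptyset\text{ for some }l\in\mathcal L\}$, and define $\mathrm{mult}^H_{\mathcal L}(\mathcal F)\in\mathbb N\cup\{\infty\}$ to be $\infty$ if $\mathcal L$ contains a unit; otherwise it is $0$ if $(\mathcal F:\mathcal L)=\emptyset$ and $1+\mathrm{mult}^H_{\mathcal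 L}((\mathcal F:\mathcal L))$ if not (with value $\infty$ if this recursion does not terminate). For singletons the braces are omitted. A polynomial $\tilde f=\sum a_{\bm m}\bm x^{\bm m}\in\mathbb{TR}[\bm x]$ is strictly convex if for every $\bm m$ in its support there is a nonempty open set of $\bm w\in\mathbb R^n$ on which $\nu(a_{\bm m})+\langle\bm m,\bm w\rangle=\min_{\bm m'}(\nu(a_{\bm m'})+\langle\bm m',\bm w\rangle)$. A polynomial is dense if its support is the set of all lattice points of its Newton polytope. A linear form is a polynomial of degree $1$ (a constant term is allowed). For $f\in\mathbb S[\bm x]$ let $\mathcal F\subseteq\mathbb{TR}[\bm x]$ be the set of all strictly convex $\tilde f$ with $\mathrm{ac}(\tilde f)=f$. For a linear form $l\in\mathbb S[\bm x]$ the perturbation multiplicity is $\mathrm{pmult}^{\mathbb S}_l(f)=\mathrm{mult}^{\mathbb{TR}}_{\mathrm{ac}^{-1}\{l\}}(\mathcal F)$. An $\mathbb S$-enriched tropical hypersurface is a tropical hypersurface in $\mathbb R^n$ (the bend locus of a nonzero tropical polynomial, possibly empty, weighted on its facets by the integral lengths of the dual edges) together with a sign $\pm1$ for every connected component of its complement.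 A nonzero $\tilde f\in\mathbb{TR}[\bm x]$ defines such a hypersurface $V(\tilde f)$, where a component gets the sign of the coefficient of the monomial that is minimal there. In a sum of enriched hypersurfaces the underlying sets are united, the weights added and the signs multiplied. For a set $\mathcal L\subseteq\mathbb{TR}[\bm x]$ of polynomials of degree $1$, $\mathrm{gmult}^{\mathbb S}_{\mathcal L}(V)$ is the maximum of $\sum_{i=1}^k a_i$ over all $k$, $a_i\in\mathbb Z_{\ge0}$, $l_i\in\mathcal L$ such that $V=W+\sum_{i=1}^k a_iV(l_i)$ for some $\mathbb S$-enriched tropical hypersurface $W$; and $\mathrm{gmult}^{\mathbb S}_{\mathcal L}(\mathcal F)=\max_{\tilde f\in\mathcal F}\mathrm{gmult}^{\mathbb S}_{\mathcal L}(V(\tilde f))$. **Statement.** Let $f\in\mathbb S[x_1,\dots,x_n]$ and let $l\in\mathbb S[x_1,\dots,x_n]$ be a linear form. Then $$\mathrm{pmult}^{\mathbb S}_l(f)\le\mathrm{mult}^{\mathbb S}_l(f).$$ If moreover $f$ is nonzero and dense and $l$ is not a monomial, then $$\mathrm{pmult}^{\mathbb S}_l(f)=\mathrm{gmult}^{\mathbb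 S}_{\mathrm{ac}^{-1}\{l\}}(\mathcal F).$$ -/

import Mathlib

set_option linter.unusedSectionVars false

noncomputable section

namespace TropicalMult

/-! ### Hyperfields -/

/-- A hyperfield: multiplication and `0`, `1` form a commutative group with zero, and `hadd`
is the set-valued hyperaddition. -/
class Hyperfield (H : Type*) extends CommGroupWithZero H, Neg H where
  hadd : H → H → Set H
  hadd_nonempty : ∀ a b, (hadd a b).Nonempty
  hadd_comm : ∀ a b, hadd a b = hadd b a
  zero_hadd : ∀ a, hadd 0 a = {a}
  zero_mem_hadd_iff : ∀ a b, 0 ∈ hadd a b ↔ b = -a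
  hadd_assoc : ∀ a b c, (⋃ t ∈ hadd b c, hadd a t) = ⋃ t ∈ hadd a b, hadd t c
  mem_hadd_iff : ∀ a b c, a ∈ hadd b c ↔ -b ∈ hadd (-a) c
  mul_hadd : ∀ a b c, (fun t => a * t) '' hadd b c = hadd (a * b) (a * c)


/-- Hyperaddition of subsets. -/
def setAdd {H : Type*} [Hyperfield H] (A B : Set H) : Set H :=
  ⋃ a ∈ A, ⋃ b ∈ B, Hyperfield.hadd a b

instance {H : Type*} [Hyperfield H] : Std.Commutative (setAdd (H := H)) where
  comm A B := by
    ext x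
    simp only [setAdd, Set.mem_iUnion, exists_prop]
    constructor
    · rintro ⟨a, ha, b, hb, h⟩
      exact ⟨b, hb, a, ha, Hyperfield.hadd_comm a b ▸ h⟩
    · rintro ⟨a, ha, b, hb, h⟩
      exact ⟨b, hb, a, ha, Hyperfield.hadd_comm a b ▸ h⟩

instance {H : Type*} [Hyperfield H] : Std.Associative (setAdd (H := H)) where
  assoc A B C := by
    have key : ∀ a b c x : H, (∃ t ∈ Hyperfield.hadd b c, x ∈ Hyperfield.hadd a t) ↔
        ∃ t ∈ Hyperfield.hadd a b, x ∈ Hyperfield.hadd t c := by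
      intro a b c x
      have h := Set.ext_iff.1 (Hyperfield.hadd_assoc a b c) x
      simpa only [Set.mem_iUnion, exists_prop] using h
    ext x
    simp only [setAdd, Set.mem_iUnion, exists_prop]
    constructor
    · rintro ⟨t, ⟨a, ha, b, hb, ht⟩, c, hc, hx⟩
      obtain ⟨s, hs, hx⟩ := (key a b c x).2 ⟨t, ht, hx⟩
      exact ⟨a, ha, s, ⟨b, hb, c, hc, hs⟩, hx⟩
    · rintro ⟨a, ha, s, ⟨b, hb, c, hc, hs⟩, hx⟩
      obtain ⟨t, ht, hx⟩ := (key a b c x).1 ⟨s, hs, hx⟩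
      exact ⟨t, ⟨a, ha, b, hb, ht⟩, c, hc, hx⟩

/-- The iterated hypersum of the elements `F i`, `i ∈ s`. -/
def hsum {H ι : Type*} [Hyperfield H] (s : Finset ι) (F : ι → H) : Set H :=
  s.fold setAdd {0} (fun i => {F i})

/-- The hyperfield of signs, on the set `{0, 1, -1}`. -/
instance : Hyperfield SignType where
  hadd a b := {c | a = 0 ∧ c = b ∨ b = 0 ∧ c = a ∨ a ≠ 0 ∧ b = a ∧ c = a ∨ a ≠ 0 ∧ b = -a}
  hadd_nonempty a b := by
    cases a <;> cases b <;> simp [Set.Nonempty]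
  hadd_comm a b := by
    ext c; simp only [Set.mem_ofPred_eq]; revert a b c; decide
  zero_hadd a := by
    ext c; simp only [Set.mem_ofPred_eq, Set.mem_singleton_iff]; revert a c; decide
  zero_mem_hadd_iff a b := by
    simp only [Set.mem_ofPred_eq]; revert a b; decide
  hadd_assoc a b c := by
    ext x
    simp only [Set.mem_iUnion, exists_prop, Set.mem_ofPred_eq]
    cases a <;> cases b <;> cases c <;> cases x <;> decide
  mem_hadd_iff a b c := by
    simp only [Set.mem_ofPred_eq]; revert a b c; decide
  mul_hadd a b c := by
    ext x
    simp only [Set.mem_image, Set.mem_ofPred_eq]; revert a b c x; decide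

/-- The underlying set of the tropical extension `H ⋊ Γ`: the elements `h t ^ γ` with
`h ∈ H*` and `γ ∈ Γ`, together with the zero element `∞`. -/
inductive TropExt (H Γ : Type*) [MonoidWithZero H] where
  | inf : TropExt H Γ
  | mono (h : Hˣ) (γ : Γ) : TropExt H Γ

namespace TropExt

/-- The angular component `h t ^ γ ↦ h`, `∞ ↦ 0`. -/
def ac {H Γ : Type*} [MonoidWithZero H] : TropExt H Γ → H
  | inf => 0
  | mono h _ => h

/-- The valuation `h t ^ γ ↦ γ`; the value `∞` of the zero element is `⊤`. -/
def val {H Γ : Type*} [MonoidWithZero H] : TropExt H Γ → WithTop Γ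
  | inf => ⊤
  | mono _ γ => (γ : WithTop Γ)

section Instances

variable {H Γ : Type*} [Hyperfield H] [AddCommGroup Γ] [LinearOrder Γ] [IsOrderedAddMonoid Γ]

instance : CommGroupWithZero (TropExt H Γ) where
  zero := inf
  one := mono 1 0
  mul
    | inf, _ => inf
    | _, inf => inf
    | mono h₁ γ₁, mono h₂ γ₂ => mono (h₁ * h₂) (γ₁ + γ₂)
  inv
    | inf => inf
    | mono h γ => mono h⁻¹ (-γ)
  mul_assoc := by
    rintro (_ | ⟨a, α⟩) (_ | ⟨b, β⟩) (_ | ⟨c, γ⟩) <;> try rfl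
    exact congrArg₂ mono (mul_assoc a b c) (add_assoc α β γ)
  mul_comm := by
    rintro (_ | ⟨a, α⟩) (_ | ⟨b, β⟩) <;> try rfl
    exact congrArg₂ mono (mul_comm a b) (add_comm α β)
  one_mul := by
    rintro (_ | ⟨a, α⟩)
    · rfl
    · exact congrArg₂ mono (one_mul a) (zero_add α)
  mul_one := by
    rintro (_ | ⟨a, α⟩)
    · rfl
    · exact congrArg₂ mono (mul_one a) (add_zero α)
  zero_mul := by rintro (_ | _) <;> rfl
  mul_zero := by rintro (_ | _) <;> rfl
  exists_pair_ne := ⟨inf, mono 1 0, nofun⟩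
  inv_zero := rfl
  mul_inv_cancel := by
    rintro (_ | ⟨a, α⟩) h
    · exact absurd rfl h
    · exact congrArg₂ mono (mul_inv_cancel a) (add_neg_cancel α)

/-- The hyperaddition of the tropical extension. -/
def tadd : TropExt H Γ → TropExt H Γ → Set (TropExt H Γ)
  | inf, y => {y}
  | x, inf => {x}
  | mono h₁ γ₁, mono h₂ γ₂ =>
    if γ₁ < γ₂ then {mono h₁ γ₁}
    else if γ₂ < γ₁ then {mono h₂ γ₂}
    else {z | (∃ h : Hˣ, (h : H) ∈ Hyperfield.hadd (h₁ : H) h₂ ∧ z = mono h γ₁) ∨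
      ((0 : H) ∈ Hyperfield.hadd (h₁ : H) h₂ ∧ (γ₁ : WithTop Γ) < z.val)}

theorem neg_ne {a : H} (h : a ≠ 0) : -a ≠ 0 := fun h0 => by
  have h1 := (Hyperfield.zero_mem_hadd_iff a 0).2 h0.symm
  rw [Hyperfield.hadd_comm, Hyperfield.zero_hadd] at h1
  exact h h1.symm

/-- Additive inverses: `-(h t ^ γ) = (-h) t ^ γ`. -/
instance : Neg (TropExt H Γ) where
  neg
    | inf => inf
    | mono h γ => mono (Units.mk0 (-(h : H)) (neg_ne h.ne_zero)) γ

theorem hneg_neg (a : H) : - -a = a := by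
  have h := (Hyperfield.zero_mem_hadd_iff a (-a)).2 rfl
  rw [Hyperfield.hadd_comm, Hyperfield.zero_mem_hadd_iff] at h
  exact h.symm

theorem tneg_neg (a : TropExt H Γ) : - -a = a := by
  cases a with
  | inf => rfl
  | mono h γ => exact congrArg (mono · γ) (Units.ext (hneg_neg (h : H)))

theorem hassoc {a b c t w : H} (ht : t ∈ Hyperfield.hadd b c) (hw : w ∈ Hyperfield.hadd a t) :
    ∃ s ∈ Hyperfield.hadd a b, w ∈ Hyperfield.hadd s c := by
  have h := Set.ext_iff.1 (Hyperfield.hadd_assoc a b c) w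
  simp only [Set.mem_iUnion, exists_prop] at h
  exact h.1 ⟨t, ht, hw⟩

theorem mem_inf_left {x y : TropExt H Γ} : x ∈ tadd inf y ↔ x = y := by
  simp [tadd]

theorem mem_inf_right {x y : TropExt H Γ} : x ∈ tadd y inf ↔ x = y := by
  cases y <;> simp [tadd]

theorem mem_lt {x : TropExt H Γ} {a b : Hˣ} {α β : Γ} (h : α < β) :
    x ∈ tadd (mono a α) (mono b β) ↔ x = mono a α := by
  simp [tadd, h]

theorem mem_gt {x : TropExt H Γ} {a b : Hˣ} {α β : Γ} (h : β < α) :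
    x ∈ tadd (mono a α) (mono b β) ↔ x = mono b β := by
  simp [tadd, h, h.not_gt]

theorem mem_eq {x : TropExt H Γ} {a b : Hˣ} {α : Γ} :
    x ∈ tadd (mono a α) (mono b α) ↔
      (∃ h : Hˣ, (h : H) ∈ Hyperfield.hadd (a : H) b ∧ x = mono h α) ∨
      ((0 : H) ∈ Hyperfield.hadd (a : H) b ∧ (α : WithTop Γ) < x.val) := by
  simp [tadd]

theorem tadd_nonempty (x y : TropExt H Γ) : (tadd x y).Nonempty := by
  rcases x with _ | ⟨a, α⟩
  · exact ⟨y, mem_inf_left.2 rfl⟩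
  rcases y with _ | ⟨b, β⟩
  · exact ⟨_, mem_inf_right.2 rfl⟩
  rcases lt_trichotomy α β with h | rfl | h
  · exact ⟨_, (mem_lt h).2 rfl⟩
  · obtain ⟨c, hc⟩ := Hyperfield.hadd_nonempty (a : H) b
    by_cases h0 : c = 0
    · exact ⟨inf, mem_eq.2 (Or.inr ⟨h0 ▸ hc, WithTop.coe_lt_top _⟩)⟩
    · exact ⟨mono (Units.mk0 c h0) α, mem_eq.2 (Or.inl ⟨_, hc, rfl⟩)⟩
  · exact ⟨_, (mem_gt h).2 rfl⟩

theorem tadd_comm_mem {x y z : TropExt H Γ} (hz : z ∈ tadd x y) : z ∈ tadd y x := by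
  rcases x with _ | ⟨a, α⟩
  · exact mem_inf_right.2 (mem_inf_left.1 hz)
  rcases y with _ | ⟨b, β⟩
  · exact mem_inf_left.2 (mem_inf_right.1 hz)
  rcases lt_trichotomy α β with h | rfl | h
  · exact (mem_gt h).2 ((mem_lt h).1 hz)
  · rw [mem_eq, Hyperfield.hadd_comm]
    exact mem_eq.1 hz
  · exact (mem_lt h).2 ((mem_gt h).1 hz)

theorem zero_mem_tadd_iff (x y : TropExt H Γ) : 0 ∈ tadd x y ↔ y = -x := by
  change inf ∈ tadd x y ↔ _
  rcases x with _ | ⟨a, α⟩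
  · exact mem_inf_left.trans eq_comm
  rcases y with _ | ⟨b, β⟩
  · rw [mem_inf_right]
    exact ⟨nofun, nofun⟩
  change _ ↔ mono b β = mono (Units.mk0 (-(a : H)) _) α
  rcases lt_trichotomy α β with h | rfl | h
  · rw [mem_lt h]
    simp [h.ne']
  · rw [mem_eq, Hyperfield.zero_mem_hadd_iff]
    simp [val, Units.ext_iff]
  · rw [mem_gt h]
    simp [h.ne]

theorem lt_val_of_mem {x y z : TropExt H Γ} {γ : Γ} (hx : (γ : WithTop Γ) < x.val)
    (hy : (γ : WithTop Γ) < y.val) (hz : z ∈ tadd x y) : (γ : WithTop Γ) < z.val := by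
  rcases x with _ | ⟨a, α⟩
  · exact mem_inf_left.1 hz ▸ hy
  rcases y with _ | ⟨b, β⟩
  · exact mem_inf_right.1 hz ▸ hx
  rcases lt_trichotomy α β with h | rfl | h
  · exact (mem_lt h).1 hz ▸ hx
  · rcases mem_eq.1 hz with ⟨u, -, rfl⟩ | ⟨-, h⟩
    · exact hx
    · exact hx.trans h
  · exact (mem_gt h).1 hz ▸ hy

theorem mem_of_lt_val {x : TropExt H Γ} {c : Hˣ} {γ : Γ} (hx : (γ : WithTop Γ) < x.val) :
    mono c γ ∈ tadd x (mono c γ) := by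
  rcases x with _ | ⟨a, α⟩
  · exact mem_inf_left.2 rfl
  · exact (mem_gt (WithTop.coe_lt_coe.1 hx)).2 rfl

theorem tadd_rev {x y z : TropExt H Γ} (h : x ∈ tadd y z) : -y ∈ tadd (-x) z := by
  rcases y with _ | ⟨b, β⟩
  · rw [mem_inf_left.1 h]
    exact tadd_comm_mem ((zero_mem_tadd_iff z (-z)).2 rfl)
  rcases z with _ | ⟨c, γ⟩
  · rw [mem_inf_right.1 h]
    exact mem_inf_right.2 rfl
  rcases x with _ | ⟨a, α⟩
  · exact mem_inf_left.2 ((zero_mem_tadd_iff _ _).1 h).symm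
  change mono (Units.mk0 (-(b : H)) _) β ∈ tadd (mono (Units.mk0 (-(a : H)) _) α) (mono c γ)
  rcases lt_trichotomy β γ with hl | rfl | hl
  · obtain ⟨rfl, rfl⟩ := mono.inj ((mem_lt hl).1 h)
    exact (mem_lt hl).2 rfl
  · rcases mem_eq.1 h with ⟨u, hu, he⟩ | ⟨h0, hv⟩
    · obtain ⟨rfl, rfl⟩ := mono.inj he
      exact mem_eq.2 (Or.inl ⟨Units.mk0 (-(b : H)) (neg_ne b.ne_zero),
        (Hyperfield.mem_hadd_iff _ _ _).1 hu, rfl⟩)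
    · have hc := (Hyperfield.zero_mem_hadd_iff _ _).1 h0
      rw [mem_gt (WithTop.coe_lt_coe.1 hv)]
      exact congrArg (mono · β) (Units.ext hc.symm)
  · obtain ⟨rfl, rfl⟩ := mono.inj ((mem_gt hl).1 h)
    exact mem_eq.2 (Or.inr ⟨by
      rw [Hyperfield.hadd_comm]; exact (Hyperfield.zero_mem_hadd_iff _ _).2 rfl,
      WithTop.coe_lt_coe.2 hl⟩)

theorem tassoc {x y z t w : TropExt H Γ} (ht : t ∈ tadd y z) (hw : w ∈ tadd x t) :
    ∃ s ∈ tadd x y, w ∈ tadd s z := by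
  rcases x with _ | ⟨a, α⟩
  · exact ⟨y, mem_inf_left.2 rfl, mem_inf_left.1 hw ▸ ht⟩
  rcases y with _ | ⟨b, β⟩
  · exact ⟨_, mem_inf_right.2 rfl, mem_inf_left.1 ht ▸ hw⟩
  rcases z with _ | ⟨c, γ⟩
  · exact ⟨w, mem_inf_right.1 ht ▸ hw, mem_inf_right.2 rfl⟩
  rcases lt_trichotomy β γ with hbc | rfl | hbc
  · -- the summand `z` does not contribute to `t`
    rw [mem_lt hbc] at ht
    subst ht
    by_cases hwc : w.val < γ
    · refine ⟨w, hw, ?_⟩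
      rcases w with _ | ⟨d, δ⟩
      · simp [val] at hwc
      · exact (mem_lt (WithTop.coe_lt_coe.1 hwc)).2 rfl
    · have hwb : (β : WithTop Γ) < w.val :=
        (WithTop.coe_lt_coe.2 hbc).trans_le (not_lt.1 hwc)
      obtain ⟨s, hs⟩ := tadd_nonempty (-w) (mono c γ)
      have hws : w ∈ tadd (-s) (mono c γ) := by
        have := tadd_rev hs
        rwa [tneg_neg] at this
      refine ⟨-s, ?_, hws⟩
      have hsv : (β : WithTop Γ) < (-s).val := by
        have h1 : (β : WithTop Γ) < (-w).val := by cases w <;> exact hwb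
        have h2 := lt_val_of_mem (y := mono c γ) h1 (WithTop.coe_lt_coe.2 hbc) hs
        cases s <;> exact h2
      rcases lt_trichotomy α β with hab | rfl | hab
      · rw [mem_lt hab] at hw
        subst hw
        exact absurd hwb (not_lt.2 (WithTop.coe_le_coe.2 hab.le))
      · rcases mem_eq.1 hw with ⟨u, -, rfl⟩ | ⟨h0, -⟩
        · exact absurd hwb (lt_irrefl _)
        · exact mem_eq.2 (Or.inr ⟨h0, hsv⟩)
      · rw [mem_gt hab] at hw
        subst hw
        exact absurd hwb (lt_irrefl _)
  · rcases mem_eq.1 ht with ⟨h, hh, rfl⟩ | ⟨h0, hv⟩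
    · rcases lt_trichotomy α β with hab | rfl | hab
      · rw [mem_lt hab] at hw
        subst hw
        exact ⟨_, (mem_lt hab).2 rfl, (mem_lt hab).2 rfl⟩
      · rcases mem_eq.1 hw with ⟨d, hd, rfl⟩ | ⟨h0, hv⟩
        · obtain ⟨u, hu, hd⟩ := hassoc hh hd
          by_cases hu0 : u = 0
          · subst hu0
            rw [Hyperfield.zero_hadd] at hd
            exact ⟨inf, mem_eq.2 (Or.inr ⟨hu, WithTop.coe_lt_top _⟩),
              mem_inf_left.2 (congrArg (mono · α) (Units.ext hd))⟩
          · exact ⟨mono (Units.mk0 u hu0) α, mem_eq.2 (Or.inl ⟨_, hu, rfl⟩),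
              mem_eq.2 (Or.inl ⟨_, hd, rfl⟩)⟩
        · obtain ⟨u, hu, hd⟩ := hassoc hh h0
          have hu0 : u ≠ 0 := by
            rintro rfl
            rw [Hyperfield.zero_hadd] at hd
            exact c.ne_zero hd.symm
          exact ⟨mono (Units.mk0 u hu0) α, mem_eq.2 (Or.inl ⟨_, hu, rfl⟩),
            mem_eq.2 (Or.inr ⟨hd, hv⟩)⟩
      · rw [mem_gt hab] at hw
        subst hw
        exact ⟨_, (mem_gt hab).2 rfl, mem_eq.2 (Or.inl ⟨_, hh, rfl⟩)⟩
    · rcases lt_trichotomy α β with hab | rfl | hab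
      · have hw' := tadd_comm_mem hw
        have hta : (α : WithTop Γ) < t.val := (WithTop.coe_lt_coe.2 hab).trans hv
        have hwa : w = mono a α := by
          rcases t with _ | ⟨d, δ⟩
          · exact mem_inf_left.1 hw'
          · exact (mem_gt (WithTop.coe_lt_coe.1 hta)).1 hw'
        subst hwa
        exact ⟨_, (mem_lt hab).2 rfl, (mem_lt hab).2 rfl⟩
      · have hw' := tadd_comm_mem hw
        have hwa : w = mono a α := by
          rcases t with _ | ⟨d, δ⟩
          · exact mem_inf_left.1 hw'
          · exact (mem_gt (WithTop.coe_lt_coe.1 hv)).1 hw'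
        subst hwa
        have ha0 : (a : H) ∈ Hyperfield.hadd (a : H) 0 := by
          rw [Hyperfield.hadd_comm, Hyperfield.zero_hadd]
          rfl
        obtain ⟨u, hu, hd⟩ := hassoc h0 ha0
        by_cases hu0 : u = 0
        · subst hu0
          rw [Hyperfield.zero_hadd] at hd
          exact ⟨inf, mem_eq.2 (Or.inr ⟨hu, WithTop.coe_lt_top _⟩),
            mem_inf_left.2 (congrArg (mono · α) (Units.ext hd))⟩
        · exact ⟨mono (Units.mk0 u hu0) α, mem_eq.2 (Or.inl ⟨_, hu, rfl⟩),
            mem_eq.2 (Or.inl ⟨_, hd, rfl⟩)⟩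
      · exact ⟨_, (mem_gt hab).2 rfl, mem_eq.2 (Or.inr ⟨h0,
          lt_val_of_mem (x := mono a α) (WithTop.coe_lt_coe.2 hab) hv hw⟩)⟩
  · rw [mem_gt hbc] at ht
    subst ht
    rcases lt_or_ge α β with hab | hab
    · exact ⟨_, (mem_lt hab).2 rfl, hw⟩
    · have hwc : w = mono c γ := (mem_gt (hbc.trans_le hab)).1 hw
      subst hwc
      obtain ⟨s, hs⟩ := tadd_nonempty (mono a α) (mono b β)
      exact ⟨s, hs, mem_of_lt_val (lt_val_of_mem (x := mono a α) (y := mono b β)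
        (WithTop.coe_lt_coe.2 (hbc.trans_le hab))
        (WithTop.coe_lt_coe.2 hbc) hs)⟩

theorem mul_mem_tadd {y z t : TropExt H Γ} (a : Hˣ) (α : Γ) (ht : t ∈ tadd y z) :
    mono a α * t ∈ tadd (mono a α * y) (mono a α * z) := by
  have hmul : ∀ (b : Hˣ) (β : Γ), mono a α * mono b β = mono (a * b) (α + β) := fun _ _ => rfl
  have hdis : ∀ (b c d : H), d ∈ Hyperfield.hadd b c →
      (a : H) * d ∈ Hyperfield.hadd ((a : H) * b) (a * c) := fun b c d hd => by
    rw [← Hyperfield.mul_hadd]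
    exact ⟨d, hd, rfl⟩
  rcases y with _ | ⟨b, β⟩
  · rw [mem_inf_left.1 ht]
    exact mem_inf_left.2 rfl
  rcases z with _ | ⟨c, γ⟩
  · rw [mem_inf_right.1 ht]
    exact mem_inf_right.2 rfl
  simp only [hmul]
  rcases lt_trichotomy β γ with h | rfl | h
  · rw [(mem_lt h).1 ht]
    exact (mem_lt (add_lt_add_right h α)).2 rfl
  · rcases mem_eq.1 ht with ⟨u, hu, rfl⟩ | ⟨h0, hv⟩
    · exact mem_eq.2 (Or.inl ⟨a * u, hdis _ _ _ hu, rfl⟩)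
    · refine mem_eq.2 (Or.inr ⟨by simpa using hdis _ _ _ h0, ?_⟩)
      rcases t with _ | ⟨d, δ⟩
      · exact WithTop.coe_lt_top _
      · exact WithTop.coe_lt_coe.2 (add_lt_add_right (WithTop.coe_lt_coe.1 hv) α)
  · rw [(mem_gt h).1 ht]
    exact (mem_gt (add_lt_add_right h α)).2 rfl

/-- The tropical extension `H ⋊ Γ` is a hyperfield. -/
instance : Hyperfield (TropExt H Γ) where
  hadd := tadd
  hadd_nonempty := tadd_nonempty
  hadd_comm _ _ := Set.ext fun _ => ⟨tadd_comm_mem, tadd_comm_mem⟩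
  zero_hadd _ := Set.ext fun _ => mem_inf_left
  zero_mem_hadd_iff := zero_mem_tadd_iff
  hadd_assoc x y z := by
    ext w
    simp only [Set.mem_iUnion, exists_prop]
    constructor
    · rintro ⟨t, ht, hw⟩
      exact tassoc ht hw
    · rintro ⟨t, ht, hw⟩
      obtain ⟨s, hs, hw⟩ := tassoc (tadd_comm_mem ht) (tadd_comm_mem hw)
      exact ⟨s, tadd_comm_mem hs, tadd_comm_mem hw⟩
  mem_hadd_iff x y z := ⟨tadd_rev, fun h => by
    have := tadd_rev h
    rwa [tneg_neg, tneg_neg] at this⟩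
  mul_hadd x y z := by
    ext w
    constructor
    · rintro ⟨t, ht, rfl⟩
      rcases x with _ | ⟨a, α⟩
      · exact mem_inf_left.2 rfl
      · exact mul_mem_tadd a α ht
    · intro hw
      rcases x with _ | ⟨a, α⟩
      · obtain ⟨t, ht⟩ := tadd_nonempty y z
        exact ⟨t, ht, (mem_inf_left.1 hw).symm⟩
      · have hne : (mono a α : TropExt H Γ) ≠ 0 := nofun
        have h := mul_mem_tadd a⁻¹ (-α) hw
        have hinv : (mono a⁻¹ (-α) : TropExt H Γ) = (mono a α)⁻¹ := rfl
        rw [hinv, inv_mul_cancel_left₀ hne, inv_mul_cancel_left₀ hne] at h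
        exact ⟨_, h, mul_inv_cancel_left₀ hne w⟩

end Instances

end TropExt

/-- The Krasner hyperfield, on the set `{0, 1}`. -/
abbrev Krasner : Type := WithZero Unit

theorem krasner_cases (a : Krasner) : a = 0 ∨ a = 1 := by
  rcases a with _ | ⟨⟩
  · exact Or.inl rfl
  · exact Or.inr rfl

theorem krasner_exists {p : Krasner → Prop} : (∃ a, p a) ↔ p 0 ∨ p 1 := by
  constructor
  · rintro ⟨a, h⟩
    rcases krasner_cases a with rfl | rfl
    · exact Or.inl h
    · exact Or.inr h
  · rintro (h | h)
    · exact ⟨_, h⟩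
    · exact ⟨_, h⟩

instance : Hyperfield Krasner where
  neg a := a
  hadd a b := {c | a = 0 ∧ c = b ∨ b = 0 ∧ c = a ∨ a ≠ 0 ∧ b ≠ 0}
  hadd_nonempty a b := by
    by_cases ha : a = 0
    · exact ⟨b, Or.inl ⟨ha, rfl⟩⟩
    · by_cases hb : b = 0
      · exact ⟨a, Or.inr (Or.inl ⟨hb, rfl⟩)⟩
      · exact ⟨a, Or.inr (Or.inr ⟨ha, hb⟩)⟩
  hadd_comm a b := by
    ext c; simp only [Set.mem_ofPred_eq]
    rcases krasner_cases a with rfl | rfl <;> rcases krasner_cases b with rfl | rfl <;>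
      rcases krasner_cases c with rfl | rfl <;> simp
  zero_hadd a := by
    ext c; simp only [Set.mem_ofPred_eq, Set.mem_singleton_iff]
    simp +contextual
  zero_mem_hadd_iff a b := by
    change _ ↔ b = a
    simp only [Set.mem_ofPred_eq]
    rcases krasner_cases a with rfl | rfl <;> rcases krasner_cases b with rfl | rfl <;> simp
  hadd_assoc a b c := by
    ext x
    simp only [Set.mem_iUnion, exists_prop, Set.mem_ofPred_eq]
    rcases krasner_cases a with rfl | rfl <;> rcases krasner_cases b with rfl | rfl <;>
      rcases krasner_cases c with rfl | rfl <;> rcases krasner_cases x with rfl | rfl <;>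
      simp [krasner_exists]
  mem_hadd_iff a b c := by
    change _ ↔ b ∈ {d | a = 0 ∧ d = c ∨ c = 0 ∧ d = a ∨ a ≠ 0 ∧ c ≠ 0}
    simp only [Set.mem_ofPred_eq]
    rcases krasner_cases a with rfl | rfl <;> rcases krasner_cases b with rfl | rfl <;>
      rcases krasner_cases c with rfl | rfl <;> simp
  mul_hadd a b c := by
    ext x
    simp only [Set.mem_image, Set.mem_ofPred_eq]
    rcases krasner_cases a with rfl | rfl <;> rcases krasner_cases b with rfl | rfl <;>
      rcases krasner_cases c with rfl | rfl <;> rcases krasner_cases x with rfl | rfl <;>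
      simp

/-- The tropical hyperfield `K ⋊ ℝ`. -/
abbrev Trop : Type := TropExt Krasner ℝ

/-- The tropical real hyperfield `𝕊 ⋊ ℝ`. -/
abbrev TropReal : Type := TropExt SignType ℝ

/-! ### Polynomials over a hyperfield -/

/-- Polynomials in `n` variables with coefficients in `H`: finitely supported families of
coefficients indexed by the exponents `m ∈ ℕⁿ`. -/
abbrev HPoly (n : ℕ) (H : Type*) [Zero H] : Type _ := (Fin n →₀ ℕ) →₀ H

section Poly

variable {n : ℕ} {H : Type*}

/-- The set-valued product `g · l` of two polynomials. -/
def polyMul [Hyperfield H] (g l : HPoly n H) : Set (HPoly n H) :=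
  {f | ∀ m, f m ∈ hsum (Finset.HasAntidiagonal.antidiagonal m) (fun p => g p.1 * l p.2)}

/-- `u` is a unit: the constant polynomial `1` lies in some product `u · v`. -/
def IsPolyUnit [Hyperfield H] (u : HPoly n H) : Prop :=
  ∃ v : HPoly n H, Finsupp.single 0 1 ∈ polyMul u v

/-- The (total) degree; it is `0` for the zero polynomial. -/
def totalDeg [Zero H] (f : HPoly n H) : ℕ := f.support.sup fun m => ∑ i, m i

/-- A linear form is a polynomial of degree one (a constant term is allowed). -/
def IsLinearForm [Zero H] (l : HPoly n H) : Prop := totalDeg l = 1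

/-- `l` is a monomial `c x ^ m` with `c ≠ 0`. -/
def IsMonomial [Zero H] (l : HPoly n H) : Prop := ∃ m c, c ≠ 0 ∧ l = Finsupp.single m c

/-- The point of `ℝⁿ` with the coordinates of an exponent. -/
def realPt (m : Fin n →₀ ℕ) : Fin n → ℝ := fun i => m i

/-- The Newton polytope. -/
def newton [Zero H] (f : HPoly n H) : Set (Fin n → ℝ) :=
  convexHull ℝ (realPt '' (f.support : Set (Fin n →₀ ℕ)))

/-- `f` is dense: its support consists of all lattice points of its Newton polytope. -/
def IsDense [Zero H] (f : HPoly n H) : Prop :=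
  realPt '' (f.support : Set (Fin n →₀ ℕ)) = newton f ∩ {x | ∀ i, ∃ k : ℤ, x i = k}

/-! ### The hyperfield multiplicity -/

/-- `(F : L)`, the set of all `g` such that `g · l` meets `F` for some `l ∈ L`. -/
def colon [Hyperfield H] (L F : Set (HPoly n H)) : Set (HPoly n H) :=
  {g | ∃ l ∈ L, (polyMul g l ∩ F).Nonempty}

open Classical in
/-- The hyperfield multiplicity of `L` in `F`: it is `∞` if `L` contains a unit, and otherwise
the number of times that `F ↦ (F : L)` can be applied to the nonempty set `F` until the empty
set is reached (`∞` if this never happens); see `mult_eq_zero` and `mult_eq_add_one`. -/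
def mult [Hyperfield H] (L F : Set (HPoly n H)) : ℕ∞ :=
  if ∃ u ∈ L, IsPolyUnit u then ⊤
  else ⨆ (k : ℕ) (_ : ((colon L)^[k] F).Nonempty), (k : ℕ∞)

theorem colon_empty [Hyperfield H] (L : Set (HPoly n H)) : colon L ∅ = ∅ := by
  ext g
  simp [colon]

theorem mult_eq_zero [Hyperfield H] {L F : Set (HPoly n H)} (hL : ¬ ∃ u ∈ L, IsPolyUnit u)
    (h : colon L F = ∅) : mult L F = 0 := by
  have hk : ∀ k, (colon L)^[k] (∅ : Set (HPoly n H)) = ∅ := fun k =>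
    Function.iterate_fixed (colon_empty L) k
  rw [mult, if_neg hL]
  refine le_antisymm (iSup₂_le fun k hne => ?_) bot_le
  rcases k with _ | k
  · simp
  · rw [Function.iterate_succ_apply, h, hk] at hne
    exact absurd hne Set.not_nonempty_empty

theorem mult_eq_add_one [Hyperfield H] {L F : Set (HPoly n H)}
    (hL : ¬ ∃ u ∈ L, IsPolyUnit u) (h : (colon L F).Nonempty) :
    mult L F = 1 + mult L (colon L F) := by
  rw [mult, if_neg hL, mult, if_neg hL]
  apply le_antisymm
  · refine iSup₂_le fun k hne => ?_
    rcases k with _ | k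
    · simp
    · rw [Function.iterate_succ_apply] at hne
      have := le_iSup₂ (f := fun (k : ℕ) (_ : ((colon L)^[k] (colon L F)).Nonempty) =>
        (k : ℕ∞)) k hne
      rw [Nat.cast_succ, add_comm]
      gcongr
  · rw [ENat.add_iSup]
    refine iSup_le fun k => ?_
    by_cases hk : ((colon L)^[k] (colon L F)).Nonempty
    · simp only [hk, iSup_pos]
      rw [← Function.iterate_succ_apply] at hk
      refine le_trans (le_of_eq ?_) (le_iSup₂ (k + 1) hk)
      rw [Nat.cast_succ, add_comm]
    · simp only [hk, not_false_eq_true, iSup_neg]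
      have h1 : ((colon L)^[1] F).Nonempty := h
      exact le_trans (by simp) (le_iSup₂ 1 h1)

/-! ### Tropical hypersurfaces

All notions below are attached to a polynomial `f` over `H ⋊ ℝ`. Except for the enrichment they
depend only on the valuations of the coefficients; for `H` the Krasner hyperfield, `f` is a
tropical polynomial. -/

section Hypersurface

variable [Hyperfield H]

/-- The valuation of the monomial with exponent `m` of `f` at `w`, for `m` in the support of `f`:
the real number `ν(a_m) + ⟨m, w⟩`. -/
def termVal (f : HPoly n (TropExt H ℝ)) (m : Fin n →₀ ℕ) (w : Fin n → ℝ) : ℝ :=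
  (f m).val.untopD 0 + ∑ i, (m i : ℝ) * w i

open Classical in
/-- The exponents whose monomial attains the minimum in the tropical polynomial function of `f`
at `w`; this is the support of the initial form of `f` at `w`. -/
def initSupp (f : HPoly n (TropExt H ℝ)) (w : Fin n → ℝ) : Finset (Fin n →₀ ℕ) :=
  f.support.filter fun m => ∀ m' ∈ f.support, termVal f m w ≤ termVal f m' w

/-- `f` is strictly convex: each of its monomials is essential, that is, agrees with the tropical
polynomial function of `f` on some nonempty open set. -/
def StrictlyConvex (f : HPoly n (TropExt H ℝ)) : Prop :=
  ∀ m ∈ f.support, ∃ U : Set (Fin n → ℝ), IsOpen U ∧ U.Nonempty ∧ ∀ w ∈ U, m ∈ initSupp f w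

/-- The bend locus: the points where the minimum is attained at least twice. -/
def bendLocus (f : HPoly n (TropExt H ℝ)) : Set (Fin n → ℝ) :=
  {w | 2 ≤ (initSupp f w).card}

/-- The integral length of the segment from `a` to `b`. -/
def latticeLength (a b : Fin n →₀ ℕ) : ℕ :=
  Finset.univ.gcd fun i => ((a i : ℤ) - b i).natAbs

open Classical in
/-- The weight of the tropical hypersurface of `f`. A point `w` of the bend locus lies in the
relative interior of a facet exactly if the dual cell, the convex hull of `initSupp f w`, is a
segment; its weight is then the integral length of this segment. At all other points the
value is `0`. -/
def facetWeight (f : HPoly n (TropExt H ℝ)) (w : Fin n → ℝ) : ℕ :=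
  if Collinear ℝ (realPt '' (initSupp f w : Set (Fin n →₀ ℕ))) then
    (initSupp f w).sup fun a => (initSupp f w).sup fun b => latticeLength a b
  else 0

open Classical in
/-- The enrichment defined by `f`: off the bend locus, the angular component of the coefficient
of the unique monomial attaining the minimum; by convention `0` on the bend locus. -/
def enrichment (f : HPoly n (TropExt H ℝ)) (w : Fin n → ℝ) : H :=
  if h : ∃ m, initSupp f w = {m} then (f h.choose).ac else 0

end Hypersurface

/-- The data of an enriched weighted polyhedral complex of codimension one in `ℝⁿ`: the underlying
set, the weights (a function that vanishes outside of the relative interiors of the facets), and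
the enrichment (a function on the complement, extended by `0` to the underlying set). -/
@[ext]
structure EnrichedComplex (n : ℕ) (H : Type*) where
  carrier : Set (Fin n → ℝ)
  weight : (Fin n → ℝ) → ℕ
  enrich : (Fin n → ℝ) → H

/-- The `H`-enriched tropical hypersurface `V(f)` of a nonzero polynomial over `H ⋊ ℝ`. -/
def hypersurface [Hyperfield H] (f : HPoly n (TropExt H ℝ)) : EnrichedComplex n H where
  carrier := bendLocus f
  weight := facetWeight f
  enrich := enrichment f

/-- `V` is an `H`-enriched tropical hypersurface: the underlying weighted complex is the
hypersurface of a nonzero tropical polynomial, and the enrichment assigns an element of `H*` to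
every connected component of the complement. -/
structure EnrichedComplex.IsTropicalHypersurface [Hyperfield H] (V : EnrichedComplex n H) :
    Prop where
  exists_poly : ∃ g : HPoly n Trop, g ≠ 0 ∧ V.carrier = bendLocus g ∧ V.weight = facetWeight g
  enrich_eq_zero : ∀ w ∈ V.carrier, V.enrich w = 0
  enrich_ne_zero : ∀ w ∉ V.carrier, V.enrich w ≠ 0
  enrich_const : ∀ w ∉ V.carrier, ∀ w' ∈ connectedComponentIn V.carrierᶜ w,
    V.enrich w' = V.enrich w

/-- `V = W + A 0 + ⋯ + A (k - 1)` for enriched tropical hypersurfaces: the underlying sets are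
united, the weight of a facet of `V` is the sum of the weights of the summands there (`0` away
from a summand), and the values on the components of the complement are multiplied. -/
structure EnrichedComplex.IsSum [Hyperfield H] (V W : EnrichedComplex n H) {k : ℕ}
    (A : Fin k → EnrichedComplex n H) : Prop where
  carrier_eq : V.carrier = W.carrier ∪ ⋃ i, (A i).carrier
  weight_eq : ∀ w, V.weight w ≠ 0 → V.weight w = W.weight w + ∑ i, (A i).weight w
  enrich_eq : ∀ w, w ∉ V.carrier → V.enrich w = W.enrich w * ∏ i, (A i).enrich w

/-- The `H`-enriched geometric multiplicity of `V` with respect to `L`: the maximal number of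
hypersurfaces of elements of `L`, counted with multiplicity, that split off from `V`. -/
def gmult [Hyperfield H] (L : Set (HPoly n (TropExt H ℝ))) (V : EnrichedComplex n H) : ℕ∞ :=
  ⨆ (k : ℕ) (_ : ∃ (l : Fin k → HPoly n (TropExt H ℝ)) (W : EnrichedComplex n H),
    (∀ i, l i ∈ L) ∧ W.IsTropicalHypersurface ∧ V.IsSum W fun i => hypersurface (l i)), (k : ℕ∞)

/-- The `H`-enriched geometric multiplicity of a set of polynomials: the maximum of the
multiplicities of its elements. -/
def gmultSet [Hyperfield H] (L F : Set (HPoly n (TropExt H ℝ))) : ℕ∞ :=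
  ⨆ f ∈ F, gmult L (hypersurface f)

end Poly

/-! ### The perturbation multiplicity -/

section Perturbation

variable {n : ℕ}

/-- The coefficientwise angular component `𝕊 ⋊ ℝ → 𝕊`. -/
def acPoly (f : HPoly n TropReal) : HPoly n SignType := f.mapRange TropExt.ac rfl

/-- The polynomials over `𝕊 ⋊ ℝ` with angular component `f`. -/
def acLifts (f : HPoly n SignType) : Set (HPoly n TropReal) := {g | acPoly g = f}

/-- The strictly convex polynomials with angular component `f`. -/
def convexLifts (f : HPoly n SignType) : Set (HPoly n TropReal) :=
  {g | g ∈ acLifts f ∧ StrictlyConvex g}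

/-- The perturbation multiplicity of `l` in `f`. -/
def pmult (l f : HPoly n SignType) : ℕ∞ := mult (acLifts l) (convexLifts f)

end Perturbation

end TropicalMult

/-! The inequality holds because signs are special: for nonzero signs `a`, `b` both lie in `a ⊞ b`,
and `a ⊞ -a` is everything. Hence `ac` carries hypersums of 𝕊 ⋊ ℝ into hypersums of 𝕊
(`TropExt.ac_mem_hadd`), so a chain of factorizations of a lift projects to one of `f`
(`pmult_le_mult`).

For the equality, a factorization `f ∈ g · l` over a tropical extension is compared with the
piecewise linear function `tropFun`. Cancellation may alter coefficients of a product, but never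
those that are attained alone at a generic point. So tropical functions add and enrichments multiply
(`tropFun_of_mem_polyMul`, `enrichment_of_mem_polyMul`). Additivity of functions gives additivity of
directional derivatives, that is, of support functions of initial supports. Hence bend loci are
united and lattice lengths of dual segments add. This yields `pmult ≤ gmult`.

Conversely, let `V(f) = W + ∑ V(l i)`. Then `W` is the hypersurface of some polynomial `g`
(`IsTropicalHypersurface.exists_eq_hypersurface`). A tropical function is determined by its bend
locus and weights up to a Laurent monomial (`exists_tropFun_eq_add_affine`). The monomial can be
absorbed in `g`: a linear form that is not a monomial is divisible by no variable, so no negative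
exponent arises (`zero_le_add_of_tropFun_eq`). All factors but `l 0` are multiplied in any way to a
polynomial `P`. Only the last product `P · l 0` has to contain `f` itself, and this is where strict
convexity and density enter (`mem_polyMul_of_tropFun_eq`): coefficients on the support are attained
alone somewhere, and off the support no nonzero product contributes. -/

namespace TropicalMult

open Filter Topology

/-! ### Minima of real functions on finite sets -/

section FinMin

variable {α : Type*} {M : Finset α} {φ : α → ℝ}

/-- The minimum of `φ` on `M`, with value `0` if `M` is empty. -/
def finMin (M : Finset α) (φ : α → ℝ) : ℝ := if h : M.Nonempty then M.inf' h φ else 0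

theorem finMin_le {a : α} (ha : a ∈ M) : finMin M φ ≤ φ a := by
  rw [finMin, dif_pos ⟨a, ha⟩]
  exact Finset.inf'_le _ ha

theorem exists_finMin_eq (h : M.Nonempty) : ∃ a ∈ M, finMin M φ = φ a := by
  rw [finMin, dif_pos h]
  exact Finset.exists_mem_eq_inf' h φ

theorem le_finMin {c : ℝ} (h : M.Nonempty) (hc : ∀ a ∈ M, c ≤ φ a) : c ≤ finMin M φ := by
  obtain ⟨a, ha, e⟩ := exists_finMin_eq (φ := φ) h
  exact e ▸ hc a ha

theorem finMin_eq {a : α} (ha : a ∈ M) (h : ∀ b ∈ M, φ a ≤ φ b) : finMin M φ = φ a :=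
  le_antisymm (finMin_le ha) (le_finMin ⟨a, ha⟩ h)

theorem finMin_affine {t c : ℝ} (ht : 0 ≤ t) (h : M.Nonempty) :
    finMin M (fun a => c + t * φ a) = c + t * finMin M φ := by
  obtain ⟨a, ha, e⟩ := exists_finMin_eq (φ := φ) h
  rw [e]
  refine finMin_eq ha fun b hb => ?_
  have : φ a ≤ φ b := e ▸ finMin_le hb
  gcongr

end FinMin

variable {n : ℕ}

/-! ### Lattice segments -/

theorem realPt_add (a b : Fin n →₀ ℕ) : realPt (a + b) = realPt a + realPt b := by
  ext i; simp [realPt]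

theorem realPt_injective : Function.Injective (realPt (n := n)) := fun a b h => by
  ext i
  exact Nat.cast_injective (R := ℝ) (congrFun h i)

/-- The maximal integral length of a segment with end points in `M`. -/
def maxLength (M : Finset (Fin n →₀ ℕ)) : ℕ := M.sup fun a => M.sup fun b => latticeLength a b

/-- Both sides are gcds over `j` of products of coordinate differences, which agree term by term
because the two segments are parallel. This avoids primitive vectors and any rationality assumption
on `c`. -/
theorem natAbs_mul_latticeLength {a b a' b' : Fin n →₀ ℕ} {c : ℝ}
    (h : realPt b' - realPt a' = c • (realPt b - realPt a)) (i : Fin n) :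
    ((b i : ℤ) - a i).natAbs * latticeLength b' a' =
      ((b' i : ℤ) - a' i).natAbs * latticeLength b a := by
  have h1 := Finset.gcd_mul_left (s := Finset.univ) (a := ((b i : ℤ) - a i).natAbs)
    (f := fun j => ((b' j : ℤ) - a' j).natAbs)
  have h2 := Finset.gcd_mul_left (s := Finset.univ) (a := ((b' i : ℤ) - a' i).natAbs)
    (f := fun j => ((b j : ℤ) - a j).natAbs)
  rw [normalize_eq] at h1 h2
  rw [latticeLength, latticeLength, ← h1, ← h2]
  congr 1
  ext j
  rw [← Int.natAbs_mul, ← Int.natAbs_mul]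
  congr 1
  have hi := congrFun h i
  have hj := congrFun h j
  simp only [realPt, Pi.sub_apply, Pi.smul_apply, smul_eq_mul] at hi hj
  have : ((b i : ℝ) - a i) * (b' j - a' j) = (b' i - a' i) * (b j - a j) := by
    rw [hi, hj]; ring
  exact_mod_cast this

theorem latticeLength_self (a : Fin n →₀ ℕ) : latticeLength a a = 0 := by
  simp [latticeLength, Finset.gcd_eq_zero_iff]

theorem latticeLength_eq_zero_iff {a b : Fin n →₀ ℕ} : latticeLength a b = 0 ↔ a = b := by
  refine ⟨fun h => ?_, fun h => h ▸ latticeLength_self _⟩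
  rw [latticeLength, Finset.gcd_eq_zero_iff] at h
  ext i
  have := h i (Finset.mem_univ _)
  omega

theorem latticeLength_scale {a b a' b' : Fin n →₀ ℕ} {c : ℝ}
    (h : realPt b' - realPt a' = c • (realPt b - realPt a)) :
    (latticeLength b' a' : ℝ) = |c| * latticeLength b a := by
  by_cases hab : b = a
  · subst hab
    have : realPt b' = realPt a' := by simpa [sub_eq_zero] using h
    rw [realPt_injective this, latticeLength_self, latticeLength_self]
    simp
  · obtain ⟨i, hi⟩ : ∃ i, b i ≠ a i := by
      by_contra! hc
      exact hab (Finsupp.ext hc)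
    have h1 := natAbs_mul_latticeLength h i
    have h2 : (((b i : ℤ) - a i).natAbs : ℝ) * latticeLength b' a' =
      (((b' i : ℤ) - a' i).natAbs : ℝ) * latticeLength b a := by exact_mod_cast h1
    rw [Nat.cast_natAbs, Nat.cast_natAbs] at h2
    push_cast at h2
    have h3 := congrFun h i
    simp only [realPt, Pi.sub_apply, Pi.smul_apply, smul_eq_mul] at h3
    rw [h3, abs_mul] at h2
    have h4 : |(b i : ℝ) - a i| ≠ 0 := by
      rw [abs_ne_zero, sub_ne_zero]
      exact_mod_cast hi
    apply mul_left_cancel₀ h4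
    rw [h2]; ring

/-- `M` is contained in the segment from `a` to `b`, whose end points belong to `M`. -/
structure IsSpan (M : Finset (Fin n →₀ ℕ)) (a b : Fin n →₀ ℕ) : Prop where
  left_mem : a ∈ M
  right_mem : b ∈ M
  exists_smul : ∀ m ∈ M, ∃ r : ℝ, 0 ≤ r ∧ r ≤ 1 ∧
    realPt m - realPt a = r • (realPt b - realPt a)

theorem exists_isSpan {M : Finset (Fin n →₀ ℕ)} (hM : M.Nonempty)
    (hc : Collinear ℝ (realPt '' (M : Set (Fin n →₀ ℕ)))) : ∃ a b, IsSpan M a b := by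
  obtain ⟨p, v, h⟩ := (collinear_iff_exists_forall_eq_smul_vadd _).1 hc
  have h' : ∀ m ∈ M, ∃ r : ℝ, realPt m = r • v + p := fun m hm =>
    h _ ⟨m, hm, rfl⟩
  choose! r hr using h'
  obtain ⟨a, ha, hmin⟩ := M.exists_min_image r hM
  obtain ⟨b, hb, hmax⟩ := M.exists_max_image r hM
  refine ⟨a, b, ha, hb, fun m hm => ?_⟩
  have hl := hmin m hm
  have hu := hmax m hm
  -- If the extreme parameters coincide, all points of `M` do, and any ratio in `[0, 1]` will serve.
  rcases eq_or_lt_of_le (hmin b hb) with e | hlt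
  · refine ⟨0, le_rfl, zero_le_one, ?_⟩
    rw [hr m hm, hr a ha, le_antisymm (e ▸ hu) hl]
    simp
  · have h0 : r b - r a ≠ 0 := by linarith
    refine ⟨(r m - r a) / (r b - r a), div_nonneg (by linarith) (by linarith),
      (div_le_one (by linarith)).2 (by linarith), ?_⟩
    rw [hr m hm, hr a ha, hr b hb, add_sub_add_right_eq_sub, add_sub_add_right_eq_sub,
      ← sub_smul, ← sub_smul, smul_smul, div_mul_cancel₀ _ h0]

theorem IsSpan.maxLength_eq {M : Finset (Fin n →₀ ℕ)} {a b : Fin n →₀ ℕ} (h : IsSpan M a b) :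
    maxLength M = latticeLength b a := by
  apply le_antisymm
  · refine Finset.sup_le fun m hm => Finset.sup_le fun m' hm' => ?_
    obtain ⟨r, hr0, hr1, hr⟩ := h.exists_smul m hm
    obtain ⟨r', hr0', hr1', hr'⟩ := h.exists_smul m' hm'
    have he : realPt m - realPt m' = (r - r') • (realPt b - realPt a) := by
      rw [sub_smul, ← hr, ← hr']; abel
    have hl := latticeLength_scale he
    have habs : |r - r'| ≤ 1 := abs_le.2 ⟨by linarith, by linarith⟩
    have : (latticeLength m m' : ℝ) ≤ latticeLength b a := by
      rw [hl]
      exact mul_le_of_le_one_left (Nat.cast_nonneg _) habs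
    exact_mod_cast this
  · refine le_trans ?_ (Finset.le_sup (f := fun a => M.sup fun b => latticeLength a b)
      h.right_mem)
    exact Finset.le_sup (f := fun c => latticeLength b c) h.left_mem

/-! ### Support functions and widths of finite sets of exponents -/

/-- The support function `y ↦ min_{m ∈ M} ⟨m, y⟩`. -/
def suppMin (M : Finset (Fin n →₀ ℕ)) (y : Fin n → ℝ) : ℝ := finMin M fun m => realPt m ⬝ᵥ y

/-- The width of `M` in the direction `y`. -/
def width (M : Finset (Fin n →₀ ℕ)) (y : Fin n → ℝ) : ℝ := -(suppMin M y + suppMin M (-y))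

theorem suppMin_le {M : Finset (Fin n →₀ ℕ)} {m : Fin n →₀ ℕ} (hm : m ∈ M) (y : Fin n → ℝ) :
    suppMin M y ≤ realPt m ⬝ᵥ y :=
  finMin_le (φ := fun m => realPt m ⬝ᵥ y) hm

theorem suppMin_singleton (m : Fin n →₀ ℕ) (y : Fin n → ℝ) :
    suppMin {m} y = realPt m ⬝ᵥ y :=
  finMin_eq (φ := fun m => realPt m ⬝ᵥ y) (Finset.mem_singleton_self m) fun b hb => by
    rw [Finset.mem_singleton.1 hb]

theorem abs_sub_le_width {M : Finset (Fin n →₀ ℕ)} {m m' : Fin n →₀ ℕ} (hm : m ∈ M)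
    (hm' : m' ∈ M) (y : Fin n → ℝ) : |(realPt m - realPt m') ⬝ᵥ y| ≤ width M y := by
  have h1 := suppMin_le hm y
  have h2 := suppMin_le hm' y
  have h3 := suppMin_le hm (-y)
  have h4 := suppMin_le hm' (-y)
  rw [dotProduct_neg] at h3 h4
  rw [sub_dotProduct, width, abs_le]
  constructor <;> linarith

theorem width_nonneg {M : Finset (Fin n →₀ ℕ)} (hM : M.Nonempty) (y : Fin n → ℝ) :
    0 ≤ width M y := by
  obtain ⟨m, hm⟩ := hM
  exact (abs_nonneg _).trans (abs_sub_le_width hm hm y)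

/-- The width sees direction and length of a segment but neither its position nor its orientation.
It is nonnegative, which is what makes it easier to sum than the support function. -/
theorem IsSpan.width_eq {M : Finset (Fin n →₀ ℕ)} {a b : Fin n →₀ ℕ} (h : IsSpan M a b)
    (y : Fin n → ℝ) : width M y = |(realPt b - realPt a) ⬝ᵥ y| := by
  refine le_antisymm ?_ (abs_sub_le_width h.right_mem h.left_mem y)
  obtain ⟨m, hm, e⟩ := exists_finMin_eq (M := M) (φ := fun m => realPt m ⬝ᵥ y) ⟨a, h.left_mem⟩
  obtain ⟨m', hm', e'⟩ := exists_finMin_eq (M := M) (φ := fun m => realPt m ⬝ᵥ (-y)) ⟨a, h.left_mem⟩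
  obtain ⟨r, hr0, hr1, hr⟩ := h.exists_smul m hm
  obtain ⟨r', hr0', hr1', hr'⟩ := h.exists_smul m' hm'
  have hw : width M y = (r' - r) * ((realPt b - realPt a) ⬝ᵥ y) := by
    rw [width, suppMin, suppMin, e, e', dotProduct_neg, ← smul_eq_mul, ← smul_dotProduct,
      sub_smul, ← hr, ← hr', sub_dotProduct, sub_dotProduct, sub_dotProduct]
    ring
  rw [hw]
  calc _ ≤ |(r' - r) * ((realPt b - realPt a) ⬝ᵥ y)| := le_abs_self _
    _ = |r' - r| * |(realPt b - realPt a) ⬝ᵥ y| := abs_mul _ _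
    _ ≤ _ := mul_le_of_le_one_left (abs_nonneg _) (abs_le.2 ⟨by linarith, by linarith⟩)

theorem IsSpan.suppMin_eq {M : Finset (Fin n →₀ ℕ)} {a b : Fin n →₀ ℕ} (h : IsSpan M a b)
    (y : Fin n → ℝ) :
    suppMin M y = realPt a ⬝ᵥ y + min 0 ((realPt b - realPt a) ⬝ᵥ y) := by
  apply le_antisymm
  · rw [← min_add_add_left, add_zero, ← add_dotProduct, add_sub_cancel]
    exact le_min (suppMin_le h.left_mem y) (suppMin_le h.right_mem y)
  · refine le_finMin (M := M) ⟨a, h.left_mem⟩ fun m hm => ?_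
    obtain ⟨r, hr0, hr1, hr⟩ := h.exists_smul m hm
    have : realPt m ⬝ᵥ y = realPt a ⬝ᵥ y + r * ((realPt b - realPt a) ⬝ᵥ y) := by
      rw [← smul_eq_mul, ← smul_dotProduct, ← hr, sub_dotProduct]; ring
    rw [this]
    gcongr
    rcases le_total 0 ((realPt b - realPt a) ⬝ᵥ y) with h0 | h0
    · exact (min_le_left _ _).trans (mul_nonneg hr0 h0)
    · exact (min_le_right _ _).trans (by nlinarith)

/-- A vector that is orthogonal to the orthogonal complement of `u` is a multiple of `u`. -/
theorem exists_smul_eq_of_orthogonal {u d : Fin n → ℝ}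
    (h : ∀ y, u ⬝ᵥ y = 0 → d ⬝ᵥ y = 0) : ∃ c : ℝ, d = c • u := by
  refine ⟨(d ⬝ᵥ u) / (u ⬝ᵥ u), ?_⟩
  set v := d - ((d ⬝ᵥ u) / (u ⬝ᵥ u)) • u with hv
  have h1 : u ⬝ᵥ v = 0 := by
    rw [hv, dotProduct_sub, dotProduct_smul, smul_eq_mul, dotProduct_comm u d]
    by_cases h0 : u ⬝ᵥ u = 0
    · have : u = 0 := dotProduct_self_eq_zero.1 h0
      simp [this]
    · rw [div_mul_cancel₀ _ h0, sub_self]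
  have h2 := h v h1
  have h3 : v ⬝ᵥ v = 0 := by
    conv_lhs => arg 1; rw [hv]
    rw [sub_dotProduct, smul_dotProduct, h1, h2]
    simp
  exact sub_eq_zero.1 (dotProduct_self_eq_zero.1 h3)

theorem collinear_of_smul {M : Finset (Fin n →₀ ℕ)} {a : Fin n →₀ ℕ} (ha : a ∈ M)
    {u : Fin n → ℝ} (h : ∀ m ∈ M, ∃ c : ℝ, realPt m - realPt a = c • u) :
    Collinear ℝ (realPt '' (M : Set (Fin n →₀ ℕ))) := by
  refine (collinear_iff_of_mem (Set.mem_image_of_mem realPt (Finset.mem_coe.2 ha))).2 ⟨u, ?_⟩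
  rintro _ ⟨m, hm, rfl⟩
  obtain ⟨c, hc⟩ := h m hm
  exact ⟨c, by rw [← hc]; simp⟩

/-! ### Sums of support functions -/

section SumSupp

variable {ι : Type*} [Fintype ι] {M : Finset (Fin n →₀ ℕ)} {N : ι → Finset (Fin n →₀ ℕ)}

theorem width_eq_sum (h : ∀ y, suppMin M y = ∑ i, suppMin (N i) y) (y : Fin n → ℝ) :
    width M y = ∑ i, width (N i) y := by
  simp only [width, h, Finset.sum_neg_distrib, Finset.sum_add_distrib]

theorem subsingleton_iff_width {M : Finset (Fin n →₀ ℕ)} (hM : M.Nonempty) :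
    M.card ≤ 1 ↔ ∀ y, width M y = 0 := by
  constructor
  · intro h y
    obtain ⟨m, rfl⟩ := Finset.card_eq_one.1 (le_antisymm h (Finset.card_pos.2 hM))
    rw [width, suppMin_singleton, suppMin_singleton, dotProduct_neg]
    ring
  · intro h
    refine Finset.card_le_one.2 fun a ha b hb => realPt_injective (sub_eq_zero.1 ?_)
    have := abs_sub_le_width ha hb (realPt a - realPt b)
    rw [h, abs_nonpos_iff] at this
    exact dotProduct_self_eq_zero.1 this

/-- Widths are nonnegative and additive, so their sum vanishes only if each of them does. Applied to
initial supports, this says that bend loci are united. -/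
theorem card_le_one_iff_of_suppMin_eq_sum (hM : M.Nonempty) (hN : ∀ i, (N i).Nonempty)
    (h : ∀ y, suppMin M y = ∑ i, suppMin (N i) y) :
    M.card ≤ 1 ↔ ∀ i, (N i).card ≤ 1 := by
  simp only [subsingleton_iff_width hM, fun i => subsingleton_iff_width (hN i)]
  rw [forall_comm]
  refine forall_congr' fun y => ?_
  rw [width_eq_sum h, Finset.sum_eq_zero_iff_of_nonneg fun i _ => width_nonneg (hN i) y]
  simp

/-- If the convex hull of a collinear set `M` is the Minkowski sum of the convex hulls of the
sets `N i`, then all `N i` are collinear, and lengths add up. -/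
theorem collinear_and_maxLength_of_suppMin_eq_sum (hM : M.Nonempty)
    (hN : ∀ i, (N i).Nonempty) (h : ∀ y, suppMin M y = ∑ i, suppMin (N i) y)
    (hc : Collinear ℝ (realPt '' (M : Set (Fin n →₀ ℕ)))) :
    (∀ i, Collinear ℝ (realPt '' (N i : Set (Fin n →₀ ℕ)))) ∧
      maxLength M = ∑ i, maxLength (N i) := by
  obtain ⟨a, b, hab⟩ := exists_isSpan hM hc
  set u := realPt b - realPt a with hu
  have hle : ∀ i y, width (N i) y ≤ |u ⬝ᵥ y| := fun i y => by
    rw [← hab.width_eq, width_eq_sum h]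
    exact Finset.single_le_sum (f := fun i => width (N i) y)
      (fun i _ => width_nonneg (hN i) y) (Finset.mem_univ i)
  -- The width of `N i` vanishes on the orthogonal complement of `u`, hence so do all differences of
  -- its points, which are therefore multiples of `u`.
  have hpar : ∀ i, ∀ m ∈ N i, ∀ m' ∈ N i, ∃ c : ℝ, realPt m - realPt m' = c • u := by
    intro i m hm m' hm'
    refine exists_smul_eq_of_orthogonal fun y hy => ?_
    have h1 := (abs_sub_le_width hm hm' y).trans (hle i y)
    rwa [hy, abs_zero, abs_nonpos_iff] at h1
  have hcol : ∀ i, Collinear ℝ (realPt '' (N i : Set (Fin n →₀ ℕ))) := fun i => by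
    obtain ⟨m, hm⟩ := hN i
    exact collinear_of_smul hm fun m' hm' => hpar i m' hm' m hm
  refine ⟨hcol, ?_⟩
  choose a' b' hab' using fun i => exists_isSpan (hN i) (hcol i)
  choose c hcu using fun i => hpar i (b' i) (hab' i).right_mem (a' i) (hab' i).left_mem
  have hlen : ∀ i, (maxLength (N i) : ℝ) = |c i| * latticeLength b a := fun i => by
    rw [(hab' i).maxLength_eq]
    exact latticeLength_scale (hcu i)
  have hreal : (maxLength M : ℝ) = ∑ i, (maxLength (N i) : ℝ) := by
    rw [hab.maxLength_eq]
    simp only [hlen]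
    rw [← Finset.sum_mul]
    by_cases h0 : u = 0
    · have : b = a := realPt_injective (sub_eq_zero.1 h0)
      rw [this, latticeLength_self]
      simp
    · have hw := width_eq_sum h u
      rw [hab.width_eq] at hw
      simp only [fun i => (hab' i).width_eq, hcu, smul_dotProduct, smul_eq_mul, abs_mul] at hw
      rw [← Finset.sum_mul, ← hu] at hw
      have h1 : |u ⬝ᵥ u| ≠ 0 := abs_ne_zero.2 fun e => h0 (dotProduct_self_eq_zero.1 e)
      have h2 : ∑ i, |c i| = 1 := (mul_right_cancel₀ h1 (hw.symm.trans (one_mul _).symm))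
      rw [h2, one_mul]
  exact_mod_cast hreal

end SumSupp

/-- Along a nondegenerate segment the minimum is attained twice only in directions orthogonal to it.
Thus the bend locus near a point determines the normal hyperplane of the dual segment. -/
theorem card_argmin_le_one_iff_of_isSpan {M : Finset (Fin n →₀ ℕ)} {a b : Fin n →₀ ℕ}
    (h : IsSpan M a b) (hab : a ≠ b) (y : Fin n → ℝ) :
    (M.filter fun m => realPt m ⬝ᵥ y = suppMin M y).card ≤ 1 ↔
      (realPt b - realPt a) ⬝ᵥ y ≠ 0 := by
  have hp : ∀ m ∈ M, ∃ r : ℝ, 0 ≤ r ∧ r ≤ 1 ∧ realPt m - realPt a = r • (realPt b - realPt a) ∧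
      realPt m ⬝ᵥ y = realPt a ⬝ᵥ y + r * ((realPt b - realPt a) ⬝ᵥ y) := fun m hm => by
    obtain ⟨r, hr0, hr1, hr⟩ := h.exists_smul m hm
    refine ⟨r, hr0, hr1, hr, ?_⟩
    rw [← smul_eq_mul, ← smul_dotProduct, ← hr, sub_dotProduct]; ring
  have hs := h.suppMin_eq y
  rw [Finset.card_le_one]
  constructor
  · intro h1 h0
    refine hab (h1 a ?_ b ?_)
    · rw [Finset.mem_filter, hs, h0]
      exact ⟨h.left_mem, by simp⟩
    · rw [Finset.mem_filter, hs, h0]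
      refine ⟨h.right_mem, ?_⟩
      rw [sub_dotProduct] at h0
      simp only [min_self, add_zero]
      linarith
  · intro h0 m hm m' hm'
    rw [Finset.mem_filter] at hm hm'
    obtain ⟨r, -, -, hr, e⟩ := hp m hm.1
    obtain ⟨r', -, -, hr', e'⟩ := hp m' hm'.1
    have : r = r' := mul_right_cancel₀ h0 (by linarith [hm.2, hm'.2])
    refine realPt_injective ?_
    rw [← sub_left_inj (a := realPt a), hr, hr', this]

/-- Two collinear sets with the same integral length and the same normal hyperplane have support
functions that differ by an integral linear function. -/
theorem exists_int_of_isSpan {M M' : Finset (Fin n →₀ ℕ)} {a b a' b' : Fin n →₀ ℕ}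
    (h : IsSpan M a b) (h' : IsSpan M' a' b') (hl : maxLength M = maxLength M')
    (hb : ∀ y, (M.filter fun m => realPt m ⬝ᵥ y = suppMin M y).card ≤ 1 ↔
      (M'.filter fun m => realPt m ⬝ᵥ y = suppMin M' y).card ≤ 1) :
    ∃ s : Fin n → ℤ, ∀ y, suppMin M y = suppMin M' y + (fun i => (s i : ℝ)) ⬝ᵥ y := by
  have key : ∀ p q : Fin n →₀ ℕ, (fun i => (((p i : ℤ) - q i : ℤ) : ℝ)) = realPt p - realPt q :=
    fun p q => by ext i; simp [realPt]
  rw [h.maxLength_eq, h'.maxLength_eq] at hl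
  by_cases hab : a = b
  · have hab' : b' = a' := by
      rw [hab, latticeLength_self] at hl
      exact latticeLength_eq_zero_iff.1 hl.symm
    refine ⟨fun i => (a i : ℤ) - a' i, fun y => ?_⟩
    rw [key, h.suppMin_eq, h'.suppMin_eq, hab, hab', sub_dotProduct]
    simp
  · have hab' : a' ≠ b' := fun e => by
      rw [e, latticeLength_self] at hl
      exact hab (latticeLength_eq_zero_iff.1 hl).symm
    simp only [card_argmin_le_one_iff_of_isSpan h hab, card_argmin_le_one_iff_of_isSpan h' hab',
      not_iff_not] at hb
    -- Equal normal hyperplanes make the segments parallel, and equal lengths then force `c = ±1`.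
    obtain ⟨c, hc⟩ := exists_smul_eq_of_orthogonal
      (u := realPt b - realPt a) (d := realPt b' - realPt a') fun y hy => (hb y).1 hy
    have hs := latticeLength_scale hc
    rw [← hl] at hs
    have h0 : (latticeLength b a : ℝ) ≠ 0 := by
      exact_mod_cast fun e => hab (latticeLength_eq_zero_iff.1 e).symm
    have hc1 : |c| = 1 := mul_right_cancel₀ h0 (hs.symm.trans (one_mul _).symm)
    rcases (abs_eq zero_le_one).1 hc1 with rfl | rfl
    · refine ⟨fun i => (a i : ℤ) - a' i, fun y => ?_⟩
      rw [key, h.suppMin_eq, h'.suppMin_eq, hc, one_smul, sub_dotProduct (realPt a) (realPt a')]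
      ring
    -- The segments are oppositely oriented, so `a'` corresponds to `b`.
    · refine ⟨fun i => (b i : ℤ) - a' i, fun y => ?_⟩
      rw [key, h.suppMin_eq, h'.suppMin_eq, hc, neg_one_smul, neg_dotProduct,
        sub_dotProduct (realPt b) (realPt a')]
      have : (realPt b) ⬝ᵥ y = realPt a ⬝ᵥ y + (realPt b - realPt a) ⬝ᵥ y := by
        rw [sub_dotProduct]; ring
      rw [this]
      rcases le_total 0 ((realPt b - realPt a) ⬝ᵥ y) with h0 | h0
      · rw [min_eq_left h0, min_eq_right (by linarith)]; ring
      · rw [min_eq_right h0, min_eq_left (by linarith)]; ring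

/-! ### Generic points -/

theorem dense_dotProduct_ne_zero {v : Fin n → ℝ} (hv : v ≠ 0) (c : ℝ) :
    Dense {w | c + v ⬝ᵥ w ≠ 0} := by
  intro w
  by_cases hw : c + v ⬝ᵥ w = 0
  · have ht : Tendsto (fun t : ℝ => w + t • v) (𝓝[≠] 0) (𝓝 w) := by
      have : Continuous fun t : ℝ => w + t • v := by fun_prop
      have h := this.tendsto 0
      rw [zero_smul, add_zero] at h
      exact h.mono_left nhdsWithin_le_nhds
    refine mem_closure_of_tendsto ht ?_
    filter_upwards [self_mem_nhdsWithin] with t ht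
    rw [dotProduct_add, dotProduct_smul, ← add_assoc, hw, zero_add, smul_eq_mul]
    exact mul_ne_zero ht fun h => hv (dotProduct_self_eq_zero.1 h)
  · exact subset_closure hw

theorem isOpen_and_dense_generic {κ : Type*} {S : Set κ} (hS : S.Finite) {v : κ → Fin n → ℝ}
    (c : κ → ℝ) (hv : ∀ k ∈ S, v k ≠ 0) :
    IsOpen {w | ∀ k ∈ S, c k + v k ⬝ᵥ w ≠ 0} ∧ Dense {w | ∀ k ∈ S, c k + v k ⬝ᵥ w ≠ 0} := by
  have he : {w | ∀ k ∈ S, c k + v k ⬝ᵥ w ≠ 0} = ⋂ k ∈ S, {w | c k + v k ⬝ᵥ w ≠ 0} := by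
    ext w; simp
  have ho : ∀ k ∈ S, IsOpen {w | c k + v k ⬝ᵥ w ≠ 0} := fun k _ =>
    isOpen_ne_fun (by fun_prop) continuous_const
  rw [he]
  exact ⟨hS.isOpen_biInter ho,
    dense_biInter_of_isOpen ho hS.countable fun k hk => dense_dotProduct_ne_zero (hv k hk) _⟩

/-! ### Tropical polynomial functions and their local structure -/

section TropFun

variable {H : Type*} [Hyperfield H] {f : HPoly n (TropExt H ℝ)}

/-- The tropical polynomial function of `f`. -/
def tropFun (f : HPoly n (TropExt H ℝ)) (w : Fin n → ℝ) : ℝ :=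
  finMin f.support fun m => termVal f m w

theorem tropFun_le {m : Fin n →₀ ℕ} (hm : m ∈ f.support) (w : Fin n → ℝ) :
    tropFun f w ≤ termVal f m w :=
  finMin_le (φ := fun m => termVal f m w) hm

theorem exists_tropFun_eq (hf : f ≠ 0) (w : Fin n → ℝ) :
    ∃ m ∈ f.support, tropFun f w = termVal f m w :=
  exists_finMin_eq (Finsupp.support_nonempty_iff.2 hf)

theorem mem_initSupp_iff_forall {m : Fin n →₀ ℕ} {w : Fin n → ℝ} :
    m ∈ initSupp f w ↔ m ∈ f.support ∧ ∀ m' ∈ f.support, termVal f m w ≤ termVal f m' w := by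
  rw [initSupp, Finset.mem_filter]

theorem mem_initSupp {m : Fin n →₀ ℕ} {w : Fin n → ℝ} :
    m ∈ initSupp f w ↔ m ∈ f.support ∧ termVal f m w = tropFun f w := by
  rw [mem_initSupp_iff_forall]
  refine and_congr_right fun hm => ⟨fun h => ?_, fun h m' hm' => h ▸ tropFun_le hm' w⟩
  exact (finMin_eq (φ := fun m => termVal f m w) hm h).symm

theorem initSupp_nonempty (hf : f ≠ 0) (w : Fin n → ℝ) : (initSupp f w).Nonempty := by
  obtain ⟨m, hm, e⟩ := exists_tropFun_eq hf w
  exact ⟨m, mem_initSupp.2 ⟨hm, e.symm⟩⟩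

theorem termVal_add (f : HPoly n (TropExt H ℝ)) (m : Fin n →₀ ℕ) (w y : Fin n → ℝ) :
    termVal f m (w + y) = termVal f m w + realPt m ⬝ᵥ y := by
  change _ + realPt m ⬝ᵥ (w + y) = _ + realPt m ⬝ᵥ w + _
  rw [dotProduct_add, add_assoc]

theorem continuous_termVal (f : HPoly n (TropExt H ℝ)) (m : Fin n →₀ ℕ) :
    Continuous (termVal f m) := by
  unfold termVal; fun_prop

theorem continuous_tropFun (f : HPoly n (TropExt H ℝ)) : Continuous (tropFun f) := by
  unfold tropFun finMin
  split_ifs with h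
  · exact Continuous.finset_inf'_apply h fun m _ => continuous_termVal f m
  · exact continuous_const

theorem notMem_bendLocus_iff {w : Fin n → ℝ} : w ∉ bendLocus f ↔ (initSupp f w).card ≤ 1 := by
  change ¬ 2 ≤ (initSupp f w).card ↔ _
  omega

theorem notMem_bendLocus_iff_exists (hf : f ≠ 0) {w : Fin n → ℝ} :
    w ∉ bendLocus f ↔ ∃ m, initSupp f w = {m} := by
  rw [notMem_bendLocus_iff, ← Finset.card_eq_one]
  have := Finset.card_pos.2 (initSupp_nonempty hf w)
  omega

theorem suppMin_smul {M : Finset (Fin n →₀ ℕ)} (hM : M.Nonempty) {t : ℝ} (ht : 0 ≤ t)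
    (y : Fin n → ℝ) : suppMin M (t • y) = t * suppMin M y := by
  have := finMin_affine (φ := fun m => realPt m ⬝ᵥ y) (c := 0) ht hM
  simp only [zero_add, ← smul_eq_mul, ← dotProduct_smul] at this
  exact this

/-- Near `w`, the tropical function is described by the initial support at `w`. -/
theorem eventually_tropFun_eq (hf : f ≠ 0) (w : Fin n → ℝ) : ∀ᶠ x in 𝓝 w,
    tropFun f x = tropFun f w + suppMin (initSupp f w) (x - w) ∧
    initSupp f x = (initSupp f w).filter
      fun m => realPt m ⬝ᵥ (x - w) = suppMin (initSupp f w) (x - w) := by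
  have h1 : ∀ᶠ x in 𝓝 w, ∀ m ∈ f.support, m ∉ initSupp f w → tropFun f x < termVal f m x := by
    rw [eventually_all_finset]
    intro m hm
    by_cases hmi : m ∈ initSupp f w
    · simp [hmi]
    · have hlt : tropFun f w < termVal f m w :=
        (tropFun_le hm w).lt_of_ne fun e => hmi (mem_initSupp.2 ⟨hm, e.symm⟩)
      filter_upwards [(continuous_tropFun f).continuousAt.eventually_lt
        (continuous_termVal f m).continuousAt hlt] with x hx _ using hx
  filter_upwards [h1] with x hx
  have hsub : ∀ m ∈ initSupp f x, m ∈ initSupp f w := fun m hm => by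
    rw [mem_initSupp] at hm
    by_contra hc
    exact (hx m hm.1 hc).ne' hm.2
  have hterm : ∀ m ∈ initSupp f w, termVal f m x = tropFun f w + realPt m ⬝ᵥ (x - w) :=
    fun m hm => by
      have := termVal_add f m w (x - w)
      rw [add_sub_cancel] at this
      rw [this, (mem_initSupp.1 hm).2]
  have hval : tropFun f x = tropFun f w + suppMin (initSupp f w) (x - w) := by
    apply le_antisymm
    · obtain ⟨m, hm, e⟩ := exists_finMin_eq (φ := fun m => realPt m ⬝ᵥ (x - w))
        (initSupp_nonempty hf w)
      rw [suppMin, e, ← hterm m hm]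
      exact tropFun_le (mem_initSupp.1 hm).1 x
    · obtain ⟨m, hm⟩ := initSupp_nonempty hf x
      rw [← (mem_initSupp.1 hm).2, hterm m (hsub m hm)]
      gcongr
      exact suppMin_le (hsub m hm) _
  refine ⟨hval, ?_⟩
  ext m
  rw [Finset.mem_filter]
  constructor
  · intro hm
    have h2 := (mem_initSupp.1 hm).2
    rw [hterm m (hsub m hm), hval] at h2
    exact ⟨hsub m hm, by linarith⟩
  · rintro ⟨hm, e⟩
    refine mem_initSupp.2 ⟨(mem_initSupp.1 hm).1, ?_⟩
    rw [hterm m hm, hval, e]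

theorem tendsto_ray (w y : Fin n → ℝ) : Tendsto (fun t : ℝ => w + t • y) (𝓝[>] 0) (𝓝 w) := by
  have : Continuous fun t : ℝ => w + t • y := by fun_prop
  have h := this.tendsto 0
  rw [zero_smul, add_zero] at h
  exact h.mono_left nhdsWithin_le_nhds

/-- The support function of the initial support is the one-sided directional derivative. It
therefore depends on the function `tropFun f` only, not on the coefficients that never attain the
minimum. -/
theorem eventually_tropFun_ray (hf : f ≠ 0) (w y : Fin n → ℝ) : ∀ᶠ t : ℝ in 𝓝[>] 0,
    tropFun f (w + t • y) = tropFun f w + t * suppMin (initSupp f w) y := by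
  filter_upwards [(tendsto_ray w y).eventually (eventually_tropFun_eq hf w), self_mem_nhdsWithin]
    with t h1 ht
  rw [h1.1, add_sub_cancel_left, suppMin_smul (initSupp_nonempty hf w) (le_of_lt ht)]

theorem isOpen_compl_bendLocus (hf : f ≠ 0) : IsOpen (bendLocus f)ᶜ := by
  rw [isOpen_iff_eventually]
  intro w hw
  filter_upwards [eventually_tropFun_eq hf w] with x hx
  rw [Set.mem_compl_iff, notMem_bendLocus_iff] at hw ⊢
  rw [hx.2]
  exact (Finset.card_filter_le _ _).trans hw

/-- Terms with different exponents are affine functions with different slopes, so each pair agrees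
on a hyperplane only. All pairs are separated here, not just the minimal ones; the generic segments
used for rigidity start at such points. -/
theorem exists_isOpen_dense_termVal_ne (f : HPoly n (TropExt H ℝ)) :
    ∃ G : Set (Fin n → ℝ), IsOpen G ∧ Dense G ∧ ∀ w ∈ G, ∀ a ∈ f.support, ∀ b ∈ f.support,
      a ≠ b → termVal f a w ≠ termVal f b w := by
  set S : Set ((Fin n →₀ ℕ) × (Fin n →₀ ℕ)) := {p ∈ ↑(f.support ×ˢ f.support) | p.1 ≠ p.2} with hS
  obtain ⟨ho, hd⟩ := isOpen_and_dense_generic (S := S) (v := fun p => realPt p.1 - realPt p.2)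
    ((Finset.finite_toSet _).subset (Set.sep_subset _ _))
    (fun p => (f p.1).val.untopD 0 - (f p.2).val.untopD 0)
    (fun p hp => sub_ne_zero.2 fun h => hp.2 (realPt_injective h))
  refine ⟨_, ho, hd, fun w hw a ha b hb hab h => hw (a, b)
    ⟨Finset.mem_coe.2 (Finset.mem_product.2 ⟨ha, hb⟩), hab⟩ ?_⟩
  change _ + realPt a ⬝ᵥ w = _ + realPt b ⬝ᵥ w at h
  rw [sub_dotProduct]
  linarith

theorem dense_compl_bendLocus (f : HPoly n (TropExt H ℝ)) : Dense (bendLocus f)ᶜ := by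
  obtain ⟨G, -, hd, hG⟩ := exists_isOpen_dense_termVal_ne f
  refine hd.mono fun w hw => ?_
  rw [Set.mem_compl_iff, notMem_bendLocus_iff, Finset.card_le_one]
  intro a ha b hb
  by_contra hne
  rw [mem_initSupp] at ha hb
  exact hG w hw a ha.1 b hb.1 hne (ha.2.trans hb.2.symm)

/-! ### Enrichments -/

theorem enrichment_eq_ac {w : Fin n → ℝ} {m : Fin n →₀ ℕ} (h : initSupp f w = {m}) :
    enrichment f w = (f m).ac := by
  have he : ∃ m, initSupp f w = {m} := ⟨m, h⟩
  rw [enrichment, dif_pos he]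
  have := Finset.singleton_injective (he.choose_spec.symm.trans h)
  rw [this]

theorem enrichment_eq_zero {w : Fin n → ℝ} (hw : w ∈ bendLocus f) : enrichment f w = 0 := by
  rw [enrichment, dif_neg]
  rintro ⟨m, hm⟩
  change 2 ≤ (initSupp f w).card at hw
  rw [hm, Finset.card_singleton] at hw
  omega

theorem TropExt.ac_ne_zero {x : TropExt H ℝ} (hx : x ≠ 0) : x.ac ≠ 0 := by
  cases x with
  | inf => exact absurd rfl hx
  | mono h γ => exact h.ne_zero

theorem enrichment_eq_of_mem_connectedComponentIn (hf : f ≠ 0) {w w' : Fin n → ℝ}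
    (hw : w ∉ bendLocus f) (hw' : w' ∈ connectedComponentIn (bendLocus f)ᶜ w) :
    enrichment f w' = enrichment f w := by
  -- With the discrete topology on `H`, continuity of the enrichment means local constancy, which on
  -- a preconnected set gives constancy.
  let _ : TopologicalSpace H := ⊥
  have _ : DiscreteTopology H := ⟨rfl⟩
  refine isPreconnected_connectedComponentIn.constant (s := connectedComponentIn (bendLocus f)ᶜ w)
    (f := enrichment f) (fun x hx => ?_) hw' (mem_connectedComponentIn hw)
  obtain ⟨m, hm⟩ := (notMem_bendLocus_iff_exists hf).1 (connectedComponentIn_subset _ _ hx)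
  have hc : ContinuousAt (enrichment f) x := by
    refine continuousAt_const.congr (f := fun _ => (f m).ac) ?_
    filter_upwards [eventually_tropFun_eq hf x, (isOpen_compl_bendLocus hf).mem_nhds
      (connectedComponentIn_subset _ _ hx)] with y hy hyb
    obtain ⟨m', hm'⟩ := (notMem_bendLocus_iff_exists hf).1 hyb
    have : m' ∈ initSupp f x := by
      have h1 : m' ∈ initSupp f y := hm' ▸ Finset.mem_singleton_self m'
      rw [hy.2] at h1
      exact (Finset.mem_filter.1 h1).1
    rw [hm, Finset.mem_singleton] at this
    rw [enrichment_eq_ac hm', this]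
  exact hc.continuousWithinAt

/-- The two hyperfields may differ, which permits passing between polynomials over `H ⋊ ℝ` and
tropical polynomials over the Krasner extension. -/
theorem initSupp_congr {H' : Type*} [Hyperfield H'] {g : HPoly n (TropExt H' ℝ)}
    (h : ∀ m, (f m).val = (g m).val) : initSupp f = initSupp g := by
  have h0 : ∀ m, f m = 0 ↔ g m = 0 := fun m => by
    have hm := h m
    change f m = TropExt.inf ↔ g m = TropExt.inf
    cases hf : f m <;> cases hg : g m <;> simp_all [TropExt.val]
  have hs : f.support = g.support := by
    ext m
    rw [Finsupp.mem_support_iff, Finsupp.mem_support_iff, Ne, h0]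
  funext w
  ext m
  simp only [mem_initSupp_iff_forall, hs, termVal, h]

theorem bendLocus_congr {H' : Type*} [Hyperfield H'] {g : HPoly n (TropExt H' ℝ)}
    (h : initSupp f = initSupp g) : bendLocus f = bendLocus g := by
  simp only [bendLocus, h]

theorem facetWeight_of_collinear {w : Fin n → ℝ}
    (hc : Collinear ℝ (realPt '' (initSupp f w : Set (Fin n →₀ ℕ)))) :
    facetWeight f w = maxLength (initSupp f w) := by
  rw [facetWeight, if_pos hc, maxLength]

theorem facetWeight_congr {H' : Type*} [Hyperfield H'] {g : HPoly n (TropExt H' ℝ)}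
    (h : initSupp f = initSupp g) : facetWeight f = facetWeight g := by
  funext w
  unfold facetWeight
  rw [h]

/-- Replace the angular component of a nonzero element by `u`. -/
def TropExt.setAc {H' : Type*} [Hyperfield H'] (u : H'ˣ) : TropExt H ℝ → TropExt H' ℝ
  | .inf => .inf
  | .mono _ γ => .mono u γ

/-- Replace the angular components of the nonzero coefficients of `f` by the values of `u`. -/
def setAcs {H' : Type*} [Hyperfield H'] (u : (Fin n →₀ ℕ) → H'ˣ) (f : HPoly n (TropExt H ℝ)) :
    HPoly n (TropExt H' ℝ) :=
  Finsupp.onFinset f.support (fun m => (f m).setAc (u m)) fun m h => by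
    rw [Finsupp.mem_support_iff]
    intro h0
    rw [h0] at h
    exact h rfl

theorem initSupp_setAcs {H' : Type*} [Hyperfield H'] (u : (Fin n →₀ ℕ) → H'ˣ)
    (f : HPoly n (TropExt H ℝ)) : initSupp (setAcs u f) = initSupp f :=
  initSupp_congr fun m => by
    change ((f m).setAc (u m)).val = _
    cases f m <;> rfl

theorem setAcs_ne_zero {H' : Type*} [Hyperfield H'] (u : (Fin n →₀ ℕ) → H'ˣ) (hf : f ≠ 0) :
    setAcs u f ≠ 0 := by
  obtain ⟨m, hm⟩ := Finsupp.ne_iff.1 hf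
  refine Finsupp.ne_iff.2 ⟨m, ?_⟩
  change (f m).setAc (u m) ≠ TropExt.inf
  cases h : f m with
  | inf => exact absurd h hm
  | mono a γ => exact nofun

theorem isTropicalHypersurface_hypersurface (hf : f ≠ 0) :
    (hypersurface f).IsTropicalHypersurface where
  exists_poly := ⟨setAcs (fun _ => 1) f, setAcs_ne_zero _ hf,
    (bendLocus_congr (initSupp_setAcs _ f)).symm, (facetWeight_congr (initSupp_setAcs _ f)).symm⟩
  enrich_eq_zero _ hw := enrichment_eq_zero hw
  enrich_ne_zero w hw := by
    obtain ⟨m, hm⟩ := (notMem_bendLocus_iff_exists hf).1 hw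
    change enrichment f w ≠ 0
    rw [enrichment_eq_ac hm]
    refine TropExt.ac_ne_zero (Finsupp.mem_support_iff.1 (mem_initSupp (w := w).1 ?_).1)
    rw [hm]
    exact Finset.mem_singleton_self m
  enrich_const _ hw _ hw' := enrichment_eq_of_mem_connectedComponentIn hf hw hw'

/-- The region of a monomial is an intersection of open half-spaces. Its convexity places it in a
single component of the complement of the bend locus. -/
theorem convex_setOf_initSupp_eq (f : HPoly n (TropExt H ℝ)) (m : Fin n →₀ ℕ) :
    Convex ℝ {w | initSupp f w = {m}} := by
  by_cases hm : m ∈ f.support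
  · have : {w | initSupp f w = {m}} = ⋂ m' ∈ {m' | m' ∈ f.support ∧ m' ≠ m},
        {w | (realPt m - realPt m') ⬝ᵥ w < (f m').val.untopD 0 - (f m).val.untopD 0} := by
      have hlt : ∀ m' w, (realPt m - realPt m') ⬝ᵥ w < (f m').val.untopD 0 - (f m).val.untopD 0 ↔
          termVal f m w < termVal f m' w := fun m' w => by
        change _ ↔ _ + realPt m ⬝ᵥ w < _ + realPt m' ⬝ᵥ w
        rw [sub_dotProduct]
        constructor <;> intro h <;> linarith
      ext w
      simp only [Set.mem_iInter, Set.mem_ofPred_eq, hlt]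
      constructor
      · intro h m' hm'
        have h1 : m ∈ initSupp f w := h ▸ Finset.mem_singleton_self m
        rw [(mem_initSupp.1 h1).2]
        refine (tropFun_le hm'.1 w).lt_of_ne fun e => hm'.2 ?_
        have h2 : m' ∈ initSupp f w := mem_initSupp.2 ⟨hm'.1, e.symm⟩
        rwa [h, Finset.mem_singleton] at h2
      · intro h
        have hT : tropFun f w = termVal f m w :=
          finMin_eq (φ := fun m => termVal f m w) hm fun b hb => by
            by_cases hbm : b = m
            · rw [hbm]
            · exact (h b ⟨hb, hbm⟩).le
        refine Finset.eq_singleton_iff_unique_mem.2 ⟨mem_initSupp.2 ⟨hm, hT.symm⟩, fun b hb => ?_⟩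
        by_contra hbm
        rw [mem_initSupp, hT] at hb
        exact (h b ⟨hb.1, hbm⟩).ne' hb.2
    rw [this]
    exact convex_iInter₂ fun m' _ =>
      convex_halfSpace_lt ⟨fun x y => dotProduct_add _ x y, fun c x => dotProduct_smul c _ x⟩ _
  · convert convex_empty
    refine Set.eq_empty_of_forall_notMem fun w hw => hm ?_
    have h1 : m ∈ initSupp f w := (show initSupp f w = {m} from hw) ▸ Finset.mem_singleton_self m
    exact (mem_initSupp.1 h1).1

/-- On the region of each monomial the enrichment takes one value, which is used as the new angular
component of that coefficient. Exponents without a region of their own do not matter and receive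
`1`. -/
theorem EnrichedComplex.IsTropicalHypersurface.exists_eq_hypersurface {V : EnrichedComplex n H}
    (hV : V.IsTropicalHypersurface) :
    ∃ g : HPoly n (TropExt H ℝ), g ≠ 0 ∧ V = hypersurface g := by
  obtain ⟨g, hg, hc, hw⟩ := hV.exists_poly
  have hu : ∀ m, ∃ u : Hˣ, ∀ w, initSupp g w = {m} → V.enrich w = u := fun m => by
    by_cases hm : ∃ w, initSupp g w = {m}
    · obtain ⟨w, hwm⟩ := hm
      have hsub : {w | initSupp g w = {m}} ⊆ V.carrierᶜ := fun x hx => by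
        rw [hc]
        exact (notMem_bendLocus_iff_exists hg).2 ⟨m, hx⟩
      refine ⟨Units.mk0 _ (hV.enrich_ne_zero w (hsub hwm)), fun x hx => ?_⟩
      exact hV.enrich_const w (hsub hwm) x
        ((convex_setOf_initSupp_eq g m).isPreconnected.subset_connectedComponentIn hwm hsub hx)
    · exact ⟨1, fun w hw => absurd ⟨w, hw⟩ hm⟩
  choose u hu using hu
  refine ⟨setAcs u g, setAcs_ne_zero u hg, ?_⟩
  have hi := initSupp_setAcs u g
  ext1
  · exact hc.trans (bendLocus_congr hi).symm
  · exact hw.trans (facetWeight_congr hi).symm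
  · funext w
    by_cases hwc : w ∈ bendLocus g
    · rw [hV.enrich_eq_zero w (hc ▸ hwc)]
      refine (enrichment_eq_zero (f := setAcs u g) ?_).symm
      rwa [bendLocus_congr hi]
    · obtain ⟨m, hm⟩ := (notMem_bendLocus_iff_exists hg).1 hwc
      rw [hu m w hm]
      change _ = enrichment (setAcs u g) w
      rw [enrichment_eq_ac (m := m) (by rw [hi, hm])]
      have h1 : m ∈ initSupp g w := hm ▸ Finset.mem_singleton_self m
      have h2 := Finsupp.mem_support_iff.1 (mem_initSupp.1 h1).1
      change _ = ((g m).setAc (u m)).ac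
      cases h : g m with
      | inf => exact absurd h h2
      | mono a γ => rfl

/-! ### Sums of tropical functions -/

/-- Directional derivatives at `w` add. In terms of polytopes, the dual cell of `f` is the Minkowski
sum of the dual cells of the `F i`. -/
theorem suppMin_initSupp_eq_sum {ι : Type*} [Fintype ι] {F : ι → HPoly n (TropExt H ℝ)}
    (hf : f ≠ 0) (hF : ∀ i, F i ≠ 0) (h : ∀ w, tropFun f w = ∑ i, tropFun (F i) w)
    (w y : Fin n → ℝ) :
    suppMin (initSupp f w) y = ∑ i, suppMin (initSupp (F i) w) y := by
  have h1 := eventually_tropFun_ray hf w y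
  have h2 : ∀ᶠ t : ℝ in 𝓝[>] 0, ∀ i, tropFun (F i) (w + t • y) =
      tropFun (F i) w + t * suppMin (initSupp (F i) w) y :=
    eventually_all.2 fun i => eventually_tropFun_ray (hF i) w y
  obtain ⟨t, ⟨h1, h2⟩, ht⟩ := ((h1.and h2).and self_mem_nhdsWithin).exists
  rw [h, h, Finset.sum_congr rfl fun i _ => h2 i, Finset.sum_add_distrib, ← Finset.mul_sum] at h1
  exact mul_left_cancel₀ (ne_of_gt ht) (add_left_cancel h1).symm

section Split

variable {ι : Type*} [Fintype ι] {g : HPoly n (TropExt H ℝ)} {l : ι → HPoly n (TropExt H ℝ)}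

theorem suppMin_initSupp_eq (hf : f ≠ 0) (hg : g ≠ 0) (hl : ∀ i, l i ≠ 0)
    (h : ∀ w, tropFun f w = tropFun g w + ∑ i, tropFun (l i) w) (w y : Fin n → ℝ) :
    suppMin (initSupp f w) y =
      suppMin (initSupp g w) y + ∑ i, suppMin (initSupp (l i) w) y := by
  -- `Option ι` treats `g` as one further summand, indexed by `none`.
  have := suppMin_initSupp_eq_sum (F := fun o : Option ι => o.elim g l) hf
    (by rintro (_ | i); exacts [hg, hl i])
    (fun w => by rw [Fintype.sum_option]; exact h w) w y
  rwa [Fintype.sum_option] at this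

theorem notMem_bendLocus_iff_of_tropFun_eq (hf : f ≠ 0) (hg : g ≠ 0) (hl : ∀ i, l i ≠ 0)
    (h : ∀ w, tropFun f w = tropFun g w + ∑ i, tropFun (l i) w) (w : Fin n → ℝ) :
    w ∉ bendLocus f ↔ w ∉ bendLocus g ∧ ∀ i, w ∉ bendLocus (l i) := by
  have := card_le_one_iff_of_suppMin_eq_sum (ι := Option ι) (M := initSupp f w)
    (N := fun o => o.elim (initSupp g w) fun i => initSupp (l i) w) (initSupp_nonempty hf w)
    (by rintro (_ | i); exacts [initSupp_nonempty hg w, initSupp_nonempty (hl i) w])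
    fun y => by rw [Fintype.sum_option]; exact suppMin_initSupp_eq hf hg hl h w y
  simp only [notMem_bendLocus_iff]
  rwa [Option.forall] at this

theorem bendLocus_eq_of_tropFun_eq (hf : f ≠ 0) (hg : g ≠ 0) (hl : ∀ i, l i ≠ 0)
    (h : ∀ w, tropFun f w = tropFun g w + ∑ i, tropFun (l i) w) :
    bendLocus f = bendLocus g ∪ ⋃ i, bendLocus (l i) := by
  ext w
  have := (notMem_bendLocus_iff_of_tropFun_eq hf hg hl h w)
  rw [← not_iff_not, this]
  simp

theorem facetWeight_eq_of_tropFun_eq (hf : f ≠ 0) (hg : g ≠ 0) (hl : ∀ i, l i ≠ 0)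
    (h : ∀ w, tropFun f w = tropFun g w + ∑ i, tropFun (l i) w) {w : Fin n → ℝ}
    (hc : Collinear ℝ (realPt '' (initSupp f w : Set (Fin n →₀ ℕ)))) :
    facetWeight f w = facetWeight g w + ∑ i, facetWeight (l i) w := by
  obtain ⟨h1, h2⟩ := collinear_and_maxLength_of_suppMin_eq_sum (ι := Option ι)
    (M := initSupp f w)
    (N := fun o => o.elim (initSupp g w) fun i => initSupp (l i) w) (initSupp_nonempty hf w)
    (by rintro (_ | i); exacts [initSupp_nonempty hg w, initSupp_nonempty (hl i) w])
    (fun y => by rw [Fintype.sum_option]; exact suppMin_initSupp_eq hf hg hl h w y) hc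
  rw [Fintype.sum_option] at h2
  rw [Option.forall] at h1
  simp only [Option.elim_none, Option.elim_some] at h1 h2
  rw [facetWeight_of_collinear hc, h2, facetWeight_of_collinear h1.1]
  exact congrArg _ (Finset.sum_congr rfl fun i _ => (facetWeight_of_collinear (h1.2 i)).symm)

end Split

end TropFun

/-! ### A tropical function is determined by its bend locus and the weights -/

section Rigidity

variable {H : Type*} [Hyperfield H] {f g : HPoly n (TropExt H ℝ)}

theorem affine_eq_of_eventually_eq {s s' : Fin n → ℝ} {c c' : ℝ} {y : Fin n → ℝ}
    (h : ∀ᶠ z in 𝓝 y, s ⬝ᵥ z + c = s' ⬝ᵥ z + c') : s = s' ∧ c = c' := by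
  have h0 := h.self_of_nhds
  obtain ⟨t, ht, ht0⟩ :=
    (((tendsto_ray y (s - s')).eventually h).and self_mem_nhdsWithin).exists
  have hs : s = s' := by
    refine sub_eq_zero.1 (dotProduct_self_eq_zero.1 ?_)
    refine (mul_eq_zero.1 ?_).resolve_left (ne_of_gt ht0)
    simp only [dotProduct_add, dotProduct_smul, smul_eq_mul] at ht
    rw [sub_dotProduct]
    linear_combination ht - h0
  subst hs
  exact ⟨rfl, add_left_cancel h0⟩

theorem eventually_card_argmin_le_one_iff (hf : f ≠ 0) (w y : Fin n → ℝ) :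
    ∀ᶠ t : ℝ in 𝓝[>] 0, w + t • y ∉ bendLocus f ↔ ((initSupp f w).filter
      fun m => realPt m ⬝ᵥ y = suppMin (initSupp f w) y).card ≤ 1 := by
  filter_upwards [(tendsto_ray w y).eventually (eventually_tropFun_eq hf w), self_mem_nhdsWithin]
    with t h1 ht
  have ht0 : (t : ℝ) ≠ 0 := ne_of_gt ht
  rw [notMem_bendLocus_iff, h1.2]
  simp only [add_sub_cancel_left, suppMin_smul (initSupp_nonempty hf w) (le_of_lt ht),
    dotProduct_smul, smul_eq_mul, mul_right_inj' ht0]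

/-- Where both dual cells are points or segments, the common bend locus fixes the direction and the
weight fixes the length. Only a translation of the segment remains free, and it contributes an
integral linear function. -/
theorem eventually_tropFun_sub_eq (hf : f ≠ 0) (hg : g ≠ 0) (hb : bendLocus f = bendLocus g)
    {w : Fin n → ℝ} (hcf : Collinear ℝ (realPt '' (initSupp f w : Set (Fin n →₀ ℕ))))
    (hcg : Collinear ℝ (realPt '' (initSupp g w : Set (Fin n →₀ ℕ))))
    (hw : facetWeight f w = facetWeight g w) :
    ∃ (s : Fin n → ℤ) (c : ℝ), ∀ᶠ x in 𝓝 w,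
      tropFun f x - tropFun g x = (fun i => (s i : ℝ)) ⬝ᵥ x + c := by
  obtain ⟨a, b, hab⟩ := exists_isSpan (initSupp_nonempty hf w) hcf
  obtain ⟨a', b', hab'⟩ := exists_isSpan (initSupp_nonempty hg w) hcg
  rw [facetWeight_of_collinear hcf, facetWeight_of_collinear hcg] at hw
  obtain ⟨s, hs⟩ := exists_int_of_isSpan hab hab' hw fun y => by
    obtain ⟨t, h1, h2⟩ := ((eventually_card_argmin_le_one_iff hf w y).and
      (eventually_card_argmin_le_one_iff hg w y)).exists
    rw [← h1, ← h2, hb]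
  refine ⟨s, tropFun f w - tropFun g w - (fun i => (s i : ℝ)) ⬝ᵥ w, ?_⟩
  filter_upwards [eventually_tropFun_eq hf w, eventually_tropFun_eq hg w] with x hx hx'
  rw [hx.1, hx'.1, hs, dotProduct_sub]
  ring

/-- A generic segment starting at a generic point meets the bend locus only in points that lie in
the relative interior of a facet. -/
theorem exists_isOpen_dense_collinear (hf : f ≠ 0) {w₀ : Fin n → ℝ}
    (h0 : ∀ a ∈ f.support, ∀ b ∈ f.support, a ≠ b → termVal f a w₀ ≠ termVal f b w₀) :
    ∃ G : Set (Fin n → ℝ), IsOpen G ∧ Dense G ∧ ∀ w ∈ G, ∀ x ∈ segment ℝ w₀ w,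
      Collinear ℝ (realPt '' (initSupp f x : Set (Fin n →₀ ℕ))) := by
  -- On the segment from `w₀` to `w`, simultaneous ties of terms `m₁`, `m₂` and `m₁`, `m₃` force a 2
  -- × 2 determinant to vanish, formed from the term differences at `w₀` and at `w`. It is affine in
  -- `w` with linear part `z`. A generic `w` avoids this when `z ≠ 0`, and `z = 0` makes the three
  -- exponents collinear.
  set z : (Fin n →₀ ℕ) × (Fin n →₀ ℕ) × (Fin n →₀ ℕ) → Fin n → ℝ := fun p =>
    (termVal f p.1 w₀ - termVal f p.2.2 w₀) • (realPt p.1 - realPt p.2.1) -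
      (termVal f p.1 w₀ - termVal f p.2.1 w₀) • (realPt p.1 - realPt p.2.2) with hz
  set S : Set ((Fin n →₀ ℕ) × (Fin n →₀ ℕ) × (Fin n →₀ ℕ)) :=
    {p ∈ ↑(f.support ×ˢ (f.support ×ˢ f.support)) | z p ≠ 0} with hS
  obtain ⟨ho, hd⟩ := isOpen_and_dense_generic (S := S) (v := z)
    ((Finset.finite_toSet _).subset (Set.sep_subset _ _))
    (fun p => (termVal f p.1 w₀ - termVal f p.2.2 w₀) *
        ((f p.1).val.untopD 0 - (f p.2.1).val.untopD 0) -
      (termVal f p.1 w₀ - termVal f p.2.1 w₀) *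
        ((f p.1).val.untopD 0 - (f p.2.2).val.untopD 0))
    (fun p hp => hp.2)
  refine ⟨_, ho, hd, fun w hw x hx => ?_⟩
  rcases le_or_gt (initSupp f x).card 1 with hcard | hcard
  · obtain ⟨a, ha⟩ := initSupp_nonempty hf x
    refine collinear_of_smul ha (u := 0) fun b hb => ⟨0, ?_⟩
    rw [Finset.card_le_one.1 hcard b hb a ha, sub_self, smul_zero]
  obtain ⟨m₁, hm₁, m₂, hm₂, hne⟩ := Finset.one_lt_card.1 hcard
  refine collinear_of_smul hm₁ (u := realPt m₂ - realPt m₁) fun m₃ hm₃ => ?_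
  rw [mem_initSupp] at hm₁ hm₂ hm₃
  have hA : termVal f m₁ w₀ - termVal f m₂ w₀ ≠ 0 :=
    sub_ne_zero.2 (h0 m₁ hm₁.1 m₂ hm₂.1 hne)
  have hz0 : z (m₁, m₂, m₃) = 0 := by
    by_contra hzne
    refine hw (m₁, m₂, m₃) ⟨Finset.mem_coe.2 (Finset.mem_product.2
      ⟨hm₁.1, Finset.mem_product.2 ⟨hm₂.1, hm₃.1⟩⟩), hzne⟩ ?_
    rw [segment_eq_image'] at hx
    obtain ⟨t, -, rfl⟩ := hx
    have hT : ∀ m, termVal f m (w₀ + t • (w - w₀)) =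
        (1 - t) * termVal f m w₀ + t * termVal f m w := fun m => by
      change _ + realPt m ⬝ᵥ (w₀ + t • (w - w₀)) =
        (1 - t) * (_ + realPt m ⬝ᵥ w₀) + t * (_ + realPt m ⬝ᵥ w)
      rw [dotProduct_add, dotProduct_smul, dotProduct_sub, smul_eq_mul]
      ring
    have e12 := hm₁.2.trans hm₂.2.symm
    have e13 := hm₁.2.trans hm₃.2.symm
    rw [hT, hT] at e12 e13
    -- At `t = 0` the tie would occur at `w₀`, where all terms are distinct.
    have ht : t ≠ 0 := by
      rintro rfl
      apply hA
      linarith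
    have hC : t * ((termVal f m₁ w₀ - termVal f m₃ w₀) * (termVal f m₁ w - termVal f m₂ w) -
        (termVal f m₁ w₀ - termVal f m₂ w₀) * (termVal f m₁ w - termVal f m₃ w)) = 0 := by
      linear_combination (termVal f m₁ w₀ - termVal f m₃ w₀) * e12 -
        (termVal f m₁ w₀ - termVal f m₂ w₀) * e13
    have hC' := (mul_eq_zero.1 hC).resolve_left ht
    have hv : ∀ m, termVal f m w = (f m).val.untopD 0 + realPt m ⬝ᵥ w := fun m => rfl
    rw [hv, hv, hv] at hC'
    simp only [hz, sub_dotProduct, smul_dotProduct, smul_eq_mul]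
    linear_combination hC'
  refine ⟨(termVal f m₁ w₀ - termVal f m₃ w₀) / (termVal f m₁ w₀ - termVal f m₂ w₀), ?_⟩
  have h1 := sub_eq_zero.1 hz0
  ext i
  have h2 := congrFun h1 i
  simp only [Pi.smul_apply, Pi.sub_apply, smul_eq_mul] at h2 ⊢
  rw [div_mul_eq_mul_div, eq_div_iff hA]
  linear_combination h2

/-- Two tropical polynomials with the same bend locus and the same weights differ by a Laurent
monomial. -/
theorem exists_tropFun_eq_add_affine (hf : f ≠ 0) (hg : g ≠ 0) (hb : bendLocus f = bendLocus g)
    (hw : ∀ w, Collinear ℝ (realPt '' (initSupp f w : Set (Fin n →₀ ℕ))) →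
      Collinear ℝ (realPt '' (initSupp g w : Set (Fin n →₀ ℕ))) →
      facetWeight f w = facetWeight g w) :
    ∃ (s : Fin n → ℤ) (c : ℝ), ∀ w,
      tropFun f w = tropFun g w + ((fun i => (s i : ℝ)) ⬝ᵥ w + c) := by
  obtain ⟨Gf, hfo, hfd, hGf⟩ := exists_isOpen_dense_termVal_ne f
  obtain ⟨Gg, -, hgd, hGg⟩ := exists_isOpen_dense_termVal_ne g
  obtain ⟨w₀, hw₀f, hw₀g⟩ := (hfd.inter_of_isOpen_left hgd hfo).nonempty
  obtain ⟨Sf, hSfo, hSfd, hSf⟩ := exists_isOpen_dense_collinear hf (hGf w₀ hw₀f)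
  obtain ⟨Sg, -, hSgd, hSg⟩ := exists_isOpen_dense_collinear hg (hGg w₀ hw₀g)
  have hd := hSfd.inter_of_isOpen_left hSgd hSfo
  have hloc : ∀ w ∈ Sf ∩ Sg, ∀ x ∈ segment ℝ w₀ w, ∃ (s : Fin n → ℤ) (c : ℝ),
      ∀ᶠ z in 𝓝 x, tropFun f z - tropFun g z = (fun i => (s i : ℝ)) ⬝ᵥ z + c :=
    fun w hw' x hx => eventually_tropFun_sub_eq hf hg hb (hSf w hw'.1 x hx) (hSg w hw'.2 x hx)
      (hw x (hSf w hw'.1 x hx) (hSg w hw'.2 x hx))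
  obtain ⟨w₁, hw₁⟩ := hd.nonempty
  obtain ⟨s, c, hsc⟩ := hloc w₁ hw₁ w₀ (left_mem_segment ℝ _ _)
  refine ⟨s, c, ?_⟩
  have hcont : Continuous fun w : Fin n → ℝ =>
      tropFun g w + ((fun i => (s i : ℝ)) ⬝ᵥ w + c) :=
    (continuous_tropFun g).add (by fun_prop)
  -- By continuity it suffices to treat the end points `w` of generic segments.
  refine congrFun (Continuous.ext_on hd (continuous_tropFun f) hcont fun w hwG => ?_)
  set u : Set (Fin n → ℝ) := {x | ∀ᶠ z in 𝓝 x,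
    tropFun f z - tropFun g z = (fun i => (s i : ℝ)) ⬝ᵥ z + c} with hu
  have huo : IsOpen u := isOpen_setOfPred_eventually_nhds
  -- The difference is locally affine at every point of the segment, and affine functions that agree
  -- on an open set are equal. So `u` is relatively closed in the segment as well as open, and
  -- connectedness finishes.
  have hsub : segment ℝ w₀ w ⊆ u := by
    refine (convex_segment w₀ w).isPreconnected.subset_of_closure_inter_subset huo
      ⟨w₀, left_mem_segment ℝ _ _, hsc⟩ ?_
    rintro x ⟨hxu, hxs⟩
    obtain ⟨s', c', h'⟩ := hloc w hwG x hxs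
    obtain ⟨y, hy', hyu⟩ := mem_closure_iff_nhds.1 hxu _ (eventually_eventually_nhds.2 h')
    obtain ⟨es, rfl⟩ := affine_eq_of_eventually_eq (y := y) (s := fun i => (s' i : ℝ)) (c := c')
      (s' := fun i => (s i : ℝ)) (c' := c)
      (by filter_upwards [hy', hyu] with z h1 h2 using h1.symm.trans h2)
    change ∀ᶠ z in 𝓝 x, _
    rwa [es] at h'
  have := (hsub (right_mem_segment ℝ w₀ w)).self_of_nhds
  change tropFun f w = tropFun g w + ((fun i => (s i : ℝ)) ⬝ᵥ w + c)
  linarith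

end Rigidity

/-! ### Hypersums -/

section Hsum

variable {H ι : Type*} [Hyperfield H] {s : Finset ι} {F : ι → H}

theorem hsum_empty (F : ι → H) : hsum ∅ F = {0} := Finset.fold_empty

theorem mem_hsum_insert [DecidableEq ι] {a : ι} (ha : a ∉ s) {x : H} :
    x ∈ hsum (insert a s) F ↔ ∃ y ∈ hsum s F, x ∈ Hyperfield.hadd (F a) y := by
  rw [hsum, Finset.fold_insert ha]
  simp only [setAdd, Set.mem_iUnion, Set.mem_singleton_iff, exists_prop, exists_eq_left]
  rfl

theorem hsum_nonempty (s : Finset ι) (F : ι → H) : (hsum s F).Nonempty := by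
  classical
  induction s using Finset.induction_on with
  | empty => exact ⟨0, by rw [hsum_empty]; rfl⟩
  | insert a s ha ih =>
    obtain ⟨y, hy⟩ := ih
    obtain ⟨x, hx⟩ := Hyperfield.hadd_nonempty (F a) y
    exact ⟨x, (mem_hsum_insert ha).2 ⟨y, hy, hx⟩⟩

theorem hsum_eq_zero (h : ∀ i ∈ s, F i = 0) : hsum s F = {0} := by
  classical
  induction s using Finset.induction_on with
  | empty => exact hsum_empty F
  | insert a s ha ih =>
    ext x
    rw [mem_hsum_insert ha, ih fun i hi => h i (Finset.mem_insert_of_mem hi),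
      h a (Finset.mem_insert_self a s)]
    simp [Hyperfield.zero_hadd]

end Hsum

/-! ### Valuations of hypersums over a tropical extension -/

section TropHsum

variable {H ι : Type*} [Hyperfield H] {s : Finset ι} {F : ι → TropExt H ℝ}

theorem lt_val_of_mem_hsum {γ : ℝ} (h : ∀ i ∈ s, (γ : WithTop ℝ) < (F i).val) {z : TropExt H ℝ}
    (hz : z ∈ hsum s F) : (γ : WithTop ℝ) < z.val := by
  classical
  induction s using Finset.induction_on generalizing z with
  | empty =>
    rw [hsum_empty] at hz
    rw [hz]
    exact WithTop.coe_lt_top γ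
  | insert a s ha ih =>
    obtain ⟨y, hy, hx⟩ := (mem_hsum_insert ha).1 hz
    exact TropExt.lt_val_of_mem (h a (Finset.mem_insert_self a s))
      (ih (fun i hi => h i (Finset.mem_insert_of_mem hi)) hy) hx

theorem le_val_of_mem_hsum {γ : ℝ} (h : ∀ i ∈ s, (γ : WithTop ℝ) ≤ (F i).val) {z : TropExt H ℝ}
    (hz : z ∈ hsum s F) : (γ : WithTop ℝ) ≤ z.val := by
  by_contra! hlt
  cases z with
  | inf => exact absurd hlt (not_lt.2 le_top)
  -- If the value `δ` of the sum were below `γ`, all terms would have value greater than `δ`, and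
  -- hence so would the sum.
  | mono u δ => exact lt_irrefl _ (lt_val_of_mem_hsum (fun i hi => hlt.trans_le (h i hi)) hz)

/-- A hypersum with a unique term of minimal valuation is that term. -/
theorem hsum_eq_singleton {i₀ : ι} (hi₀ : i₀ ∈ s) {u : Hˣ} {γ : ℝ} (h0 : F i₀ = .mono u γ)
    (h : ∀ i ∈ s, i ≠ i₀ → (γ : WithTop ℝ) < (F i).val) : hsum s F = {F i₀} := by
  classical
  refine Set.eq_singleton_iff_nonempty_unique_mem.2 ⟨hsum_nonempty s F, fun x hx => ?_⟩
  rw [← Finset.insert_erase hi₀, mem_hsum_insert (Finset.notMem_erase _ _)] at hx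
  obtain ⟨y, hy, hx⟩ := hx
  have hlt := lt_val_of_mem_hsum (γ := γ)
    (fun i hi => h i (Finset.mem_of_mem_erase hi) (Finset.ne_of_mem_erase hi)) hy
  rw [h0] at hx ⊢
  cases y with
  | inf => exact TropExt.mem_inf_right.1 hx
  | mono v δ => exact (TropExt.mem_lt (WithTop.coe_lt_coe.1 hlt)).1 hx

end TropHsum

/-! ### Products of tropical polynomials -/

section Product

variable {H : Type*} [Hyperfield H] {f g l : HPoly n (TropExt H ℝ)}

theorem TropExt.ac_mul (x y : TropExt H ℝ) : (x * y).ac = x.ac * y.ac := by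
  cases x with
  | inf => exact (zero_mul _).symm
  | mono a α =>
    cases y with
    | inf => exact (mul_zero _).symm
    | mono b β => exact Units.val_mul a b

theorem TropExt.val_eq_coe {x : TropExt H ℝ} (hx : x ≠ 0) :
    x.val = ((x.val.untopD 0 : ℝ) : WithTop ℝ) := by
  cases x with
  | inf => exact absurd rfl hx
  | mono a α => rfl

theorem TropExt.val_mul_eq_coe {x y : TropExt H ℝ} (hx : x ≠ 0) (hy : y ≠ 0) :
    (x * y).val = ((x.val.untopD 0 + y.val.untopD 0 : ℝ) : WithTop ℝ) := by
  cases x with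
  | inf => exact absurd rfl hx
  | mono a α =>
    cases y with
    | inf => exact absurd rfl hy
    | mono b β => rfl

theorem TropExt.lt_val_mul {x y : TropExt H ℝ} {γ : ℝ}
    (h : x ≠ 0 → y ≠ 0 → γ < x.val.untopD 0 + y.val.untopD 0) :
    (γ : WithTop ℝ) < (x * y).val := by
  by_cases hx : x = 0
  · rw [hx, zero_mul]; exact WithTop.coe_lt_top γ
  by_cases hy : y = 0
  · rw [hy, mul_zero]; exact WithTop.coe_lt_top γ
  rw [val_mul_eq_coe hx hy]
  exact WithTop.coe_lt_coe.2 (h hx hy)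

theorem TropExt.le_val_mul {x y : TropExt H ℝ} {γ : ℝ}
    (h : x ≠ 0 → y ≠ 0 → γ ≤ x.val.untopD 0 + y.val.untopD 0) :
    (γ : WithTop ℝ) ≤ (x * y).val := by
  by_cases hx : x = 0
  · rw [hx, zero_mul]; exact le_top
  by_cases hy : y = 0
  · rw [hy, mul_zero]; exact le_top
  rw [val_mul_eq_coe hx hy]
  exact WithTop.coe_le_coe.2 (h hx hy)

theorem termVal_eq (f : HPoly n (TropExt H ℝ)) (m : Fin n →₀ ℕ) (w : Fin n → ℝ) :
    termVal f m w = (f m).val.untopD 0 + realPt m ⬝ᵥ w := rfl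

/-- The subtracted pairing depends only on `p + q`, so it is constant along an antidiagonal.
Comparing valuations within one hypersum thus amounts to comparing term values at any chosen `w`. -/
theorem untopD_add_eq (g l : HPoly n (TropExt H ℝ)) (p q : Fin n →₀ ℕ) (w : Fin n → ℝ) :
    (g p).val.untopD 0 + (l q).val.untopD 0 =
      termVal g p w + termVal l q w - realPt (p + q) ⬝ᵥ w := by
  rw [termVal_eq, termVal_eq, realPt_add, add_dotProduct]
  ring

theorem ne_zero_of_mem_polyMul_left (hf : f ≠ 0) (h : f ∈ polyMul g l) : g ≠ 0 := by
  rintro rfl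
  refine hf (Finsupp.ext fun m => ?_)
  have := h m
  rwa [hsum_eq_zero fun p _ => by rw [Finsupp.coe_zero, Pi.zero_apply, zero_mul]] at this

theorem ne_zero_of_mem_polyMul_right (hf : f ≠ 0) (h : f ∈ polyMul g l) : l ≠ 0 := by
  rintro rfl
  refine hf (Finsupp.ext fun m => ?_)
  have := h m
  rwa [hsum_eq_zero fun p _ => by rw [Finsupp.coe_zero, Pi.zero_apply, mul_zero]] at this

theorem le_termVal_of_mem_polyMul (h : f ∈ polyMul g l) {m : Fin n →₀ ℕ} (hm : m ∈ f.support)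
    (w : Fin n → ℝ) : tropFun g w + tropFun l w ≤ termVal f m w := by
  have h1 := le_val_of_mem_hsum (γ := tropFun g w + tropFun l w - realPt m ⬝ᵥ w)
    (fun p hp => TropExt.le_val_mul fun hx hy => ?_) (h m)
  · rw [TropExt.val_eq_coe (Finsupp.mem_support_iff.1 hm)] at h1
    have h2 := WithTop.coe_le_coe.1 h1
    rw [termVal_eq]
    linarith
  · rw [untopD_add_eq g l p.1 p.2 w, Finset.HasAntidiagonal.mem_antidiagonal.1 hp]
    have h1 := tropFun_le (Finsupp.mem_support_iff.2 hx) w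
    have h2 := tropFun_le (Finsupp.mem_support_iff.2 hy) w
    linarith

theorem lt_add_termVal {p q p' q' : Fin n →₀ ℕ} {w : Fin n → ℝ} (hg : initSupp g w = {p})
    (hl : initSupp l w = {q}) (hp' : p' ∈ g.support) (hq' : q' ∈ l.support)
    (hne : (p', q') ≠ (p, q)) : tropFun g w + tropFun l w < termVal g p' w + termVal l q' w := by
  have h1 := tropFun_le hp' w
  have h2 := tropFun_le hq' w
  have h3 : p' ≠ p → tropFun g w < termVal g p' w := fun hpp => h1.lt_of_ne fun e =>
    hpp (Finset.mem_singleton.1 (hg ▸ mem_initSupp.2 ⟨hp', e.symm⟩))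
  have h4 : q' ≠ q → tropFun l w < termVal l q' w := fun hqq => h2.lt_of_ne fun e =>
    hqq (Finset.mem_singleton.1 (hl ▸ mem_initSupp.2 ⟨hq', e.symm⟩))
  by_cases hpp : p' = p
  · have := h4 fun hqq => hne (by rw [hpp, hqq])
    linarith
  · linarith [h3 hpp]

/-- If both minima at `w` are attained once, the pair `(p, q)` is the strict minimum on its
antidiagonal, so no cancellation can occur in this coefficient. -/
theorem hsum_eq_of_initSupp_eq_singleton {p q : Fin n →₀ ℕ} {w : Fin n → ℝ}
    (hg : initSupp g w = {p}) (hl : initSupp l w = {q}) :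
    hsum (Finset.HasAntidiagonal.antidiagonal (p + q)) (fun r => g r.1 * l r.2) =
      {g p * l q} := by
  obtain ⟨hps, hpv⟩ := mem_initSupp.1 (hg ▸ Finset.mem_singleton_self p : p ∈ initSupp g w)
  obtain ⟨hqs, hqv⟩ := mem_initSupp.1 (hl ▸ Finset.mem_singleton_self q : q ∈ initSupp l w)
  have hval := TropExt.val_mul_eq_coe (Finsupp.mem_support_iff.1 hps)
    (Finsupp.mem_support_iff.1 hqs)
  obtain ⟨u, hu⟩ : ∃ u, g p * l q = .mono u ((g p).val.untopD 0 + (l q).val.untopD 0) := by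
    cases hx : g p * l q with
    | inf =>
      rw [hx] at hval
      exact absurd hval.symm (WithTop.coe_ne_top)
    | mono u γ =>
      rw [hx] at hval
      exact ⟨u, congrArg _ (WithTop.coe_injective hval)⟩
  refine hsum_eq_singleton (F := fun r : (Fin n →₀ ℕ) × (Fin n →₀ ℕ) => g r.1 * l r.2)
    (i₀ := (p, q)) (Finset.HasAntidiagonal.mem_antidiagonal.2 rfl) hu fun r hr hne => ?_
  refine TropExt.lt_val_mul fun hx hy => ?_
  rw [untopD_add_eq g l p q w, untopD_add_eq g l r.1 r.2 w,
    Finset.HasAntidiagonal.mem_antidiagonal.1 hr, hpv, hqv]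
  have := lt_add_termVal hg hl (Finsupp.mem_support_iff.2 hx) (Finsupp.mem_support_iff.2 hy) hne
  linarith

theorem apply_add_of_mem_polyMul (h : f ∈ polyMul g l) {p q : Fin n →₀ ℕ} {w : Fin n → ℝ}
    (hg : initSupp g w = {p}) (hl : initSupp l w = {q}) : f (p + q) = g p * l q := by
  have := h (p + q)
  rwa [hsum_eq_of_initSupp_eq_singleton hg hl] at this

theorem tropFun_and_initSupp_of_mem_polyMul (h : f ∈ polyMul g l) {p q : Fin n →₀ ℕ}
    {w : Fin n → ℝ} (hg : initSupp g w = {p}) (hl : initSupp l w = {q}) :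
    tropFun f w = tropFun g w + tropFun l w ∧ initSupp f w = {p + q} := by
  obtain ⟨hps, hpv⟩ := mem_initSupp.1 (hg ▸ Finset.mem_singleton_self p : p ∈ initSupp g w)
  obtain ⟨hqs, hqv⟩ := mem_initSupp.1 (hl ▸ Finset.mem_singleton_self q : q ∈ initSupp l w)
  have hpq := apply_add_of_mem_polyMul h hg hl
  have hps' := Finsupp.mem_support_iff.1 hps
  have hqs' := Finsupp.mem_support_iff.1 hqs
  have hs : p + q ∈ f.support := by
    rw [Finsupp.mem_support_iff, hpq]
    exact mul_ne_zero hps' hqs'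
  have hv : termVal f (p + q) w = tropFun g w + tropFun l w := by
    rw [termVal_eq, hpq, TropExt.val_mul_eq_coe hps' hqs', WithTop.untopD_coe,
      untopD_add_eq g l p q w, hpv, hqv]
    ring
  have hT : tropFun f w = tropFun g w + tropFun l w := by
    rw [← hv]
    refine finMin_eq (φ := fun m => termVal f m w) hs fun m hm => ?_
    rw [hv]
    exact le_termVal_of_mem_polyMul h hm w
  refine ⟨hT, Finset.eq_singleton_iff_unique_mem.2
    ⟨mem_initSupp.2 ⟨hs, hv.trans hT.symm⟩, fun m hm => ?_⟩⟩
  obtain ⟨hms, hmv⟩ := mem_initSupp.1 hm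
  by_contra hne
  have h1 := lt_val_of_mem_hsum (γ := tropFun g w + tropFun l w - realPt m ⬝ᵥ w)
    (fun r hr => TropExt.lt_val_mul fun hx hy => ?_) (h m)
  · rw [TropExt.val_eq_coe (Finsupp.mem_support_iff.1 hms)] at h1
    have h2 := WithTop.coe_lt_coe.1 h1
    rw [termVal_eq] at hmv
    linarith
  · have hr' := Finset.HasAntidiagonal.mem_antidiagonal.1 hr
    rw [untopD_add_eq g l r.1 r.2 w, hr']
    have := lt_add_termVal hg hl (Finsupp.mem_support_iff.2 hx) (Finsupp.mem_support_iff.2 hy)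
      (fun e => hne (by rw [← hr', (Prod.mk.inj e).1, (Prod.mk.inj e).2]))
    linarith

theorem dense_compl_bendLocus_inter (hg : g ≠ 0) :
    Dense ((bendLocus g)ᶜ ∩ (bendLocus l)ᶜ) :=
  (dense_compl_bendLocus g).inter_of_isOpen_left (dense_compl_bendLocus l)
    (isOpen_compl_bendLocus hg)

theorem ne_zero_of_mem_polyMul (h : f ∈ polyMul g l) (hg : g ≠ 0) (hl : l ≠ 0) : f ≠ 0 := by
  obtain ⟨w, hwg, hwl⟩ := (dense_compl_bendLocus_inter (g := g) (l := l) hg).nonempty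
  obtain ⟨p, hp⟩ := (notMem_bendLocus_iff_exists hg).1 hwg
  obtain ⟨q, hq⟩ := (notMem_bendLocus_iff_exists hl).1 hwl
  rintro rfl
  have := (tropFun_and_initSupp_of_mem_polyMul h hp hq).2
  have h1 : p + q ∈ initSupp (0 : HPoly n (TropExt H ℝ)) w := this ▸ Finset.mem_singleton_self _
  simpa using (mem_initSupp.1 h1).1

/-- Both minima are attained once on a dense set, where the equality is read off from a coefficient
free of cancellation. Continuity extends it to all points. -/
theorem tropFun_of_mem_polyMul (h : f ∈ polyMul g l) (hg : g ≠ 0) (hl : l ≠ 0)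
    (w : Fin n → ℝ) : tropFun f w = tropFun g w + tropFun l w := by
  refine congrFun (Continuous.ext_on (dense_compl_bendLocus_inter (g := g) (l := l) hg)
    (continuous_tropFun f) (((continuous_tropFun g).add (continuous_tropFun l)) :
      Continuous fun w => tropFun g w + tropFun l w) ?_) w
  rintro w ⟨hwg, hwl⟩
  obtain ⟨p, hp⟩ := (notMem_bendLocus_iff_exists hg).1 hwg
  obtain ⟨q, hq⟩ := (notMem_bendLocus_iff_exists hl).1 hwl
  exact (tropFun_and_initSupp_of_mem_polyMul h hp hq).1

theorem enrichment_of_mem_polyMul (h : f ∈ polyMul g l) (hg : g ≠ 0) (hl : l ≠ 0)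
    {w : Fin n → ℝ} (hwg : w ∉ bendLocus g) (hwl : w ∉ bendLocus l) :
    enrichment f w = enrichment g w * enrichment l w := by
  obtain ⟨p, hp⟩ := (notMem_bendLocus_iff_exists hg).1 hwg
  obtain ⟨q, hq⟩ := (notMem_bendLocus_iff_exists hl).1 hwl
  rw [enrichment_eq_ac hp, enrichment_eq_ac hq,
    enrichment_eq_ac (tropFun_and_initSupp_of_mem_polyMul h hp hq).2,
    apply_add_of_mem_polyMul h hp hq, TropExt.ac_mul]

/-- Coefficients can be chosen independently of each other. The result has finite support because
outside the sumset of the supports the hypersum is `{0}`. -/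
theorem polyMul_nonempty {H : Type*} [Hyperfield H] (g l : HPoly n H) :
    (polyMul g l).Nonempty := by
  classical
  have h : ∀ m, ∃ x, x ∈ hsum (Finset.HasAntidiagonal.antidiagonal m)
      (fun p => g p.1 * l p.2) := fun m => hsum_nonempty _ _
  choose x hx using h
  refine ⟨Finsupp.onFinset ((g.support ×ˢ l.support).image fun p => p.1 + p.2) x
    fun m hm => ?_, hx⟩
  by_contra hc
  refine hm ?_
  have h1 := hx m
  rw [hsum_eq_zero fun p hp => ?_] at h1
  · exact h1
  · by_contra hne
    refine hc (Finset.mem_image.2 ⟨p, Finset.mem_product.2 ⟨?_, ?_⟩,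
      Finset.HasAntidiagonal.mem_antidiagonal.1 hp⟩)
    · exact Finsupp.mem_support_iff.2 (left_ne_zero_of_mul hne)
    · exact Finsupp.mem_support_iff.2 (right_ne_zero_of_mul hne)

end Product

/-! ### Iterated products -/

section Iterate

variable {H : Type*} [Hyperfield H]

theorem colon_mono {K : Type*} [Hyperfield K] {L F F' : Set (HPoly n K)} (h : F ⊆ F') :
    colon L F ⊆ colon L F' := by
  rintro g ⟨l, hl, f, hf, hfF⟩
  exact ⟨l, hl, f, hf, h hfF⟩

theorem colon_iterate_mono {K : Type*} [Hyperfield K] (L : Set (HPoly n K)) (k : ℕ) :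
    Monotone (colon L)^[k] :=
  Monotone.iterate (fun _ _ h => colon_mono h) k

/-- The tropical function and the enrichment of `f` are those of a product of `g` and the
polynomials `l i`. -/
structure TropSplit (f g : HPoly n (TropExt H ℝ)) {k : ℕ} (l : Fin k → HPoly n (TropExt H ℝ)) :
    Prop where
  tropFun_eq : ∀ w, tropFun f w = tropFun g w + ∑ i, tropFun (l i) w
  enrichment_eq : ∀ w ∉ bendLocus f, enrichment f w = enrichment g w * ∏ i, enrichment (l i) w

variable {f g h l₀ : HPoly n (TropExt H ℝ)} {k : ℕ} {l : Fin k → HPoly n (TropExt H ℝ)}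

theorem notMem_bendLocus_iff_of_tropFun_eq_add (hf : f ≠ 0) (hg : g ≠ 0) (hl : l₀ ≠ 0)
    (h : ∀ w, tropFun f w = tropFun g w + tropFun l₀ w) (w : Fin n → ℝ) :
    w ∉ bendLocus f ↔ w ∉ bendLocus g ∧ w ∉ bendLocus l₀ := by
  have := notMem_bendLocus_iff_of_tropFun_eq (ι := Unit) (l := fun _ => l₀) hf hg (fun _ => hl)
    (fun w => by rw [Fintype.sum_unique]; exact h w) w
  rwa [forall_const] at this

theorem TropSplit.cons (hs : TropSplit h g l) (hm : f ∈ polyMul h l₀) (hh : h ≠ 0)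
    (hl₀ : l₀ ≠ 0) : TropSplit f g (Fin.cons l₀ l : Fin (k + 1) → HPoly n (TropExt H ℝ)) where
  tropFun_eq w := by
    rw [tropFun_of_mem_polyMul hm hh hl₀, hs.tropFun_eq, Fin.sum_univ_succ]
    simp only [Fin.cons_zero, Fin.cons_succ]
    ring
  enrichment_eq w hw := by
    obtain ⟨h1, h2⟩ := (notMem_bendLocus_iff_of_tropFun_eq_add (ne_zero_of_mem_polyMul hm hh hl₀)
      hh hl₀ (tropFun_of_mem_polyMul hm hh hl₀) w).1 hw
    rw [enrichment_of_mem_polyMul hm hh hl₀ h1 h2, hs.enrichment_eq w h1, Fin.prod_univ_succ]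
    simp only [Fin.cons_zero, Fin.cons_succ]
    rw [mul_assoc, mul_comm (∏ i, _)]

theorem TropSplit.isSum (hs : TropSplit f g l) (hf : f ≠ 0) (hg : g ≠ 0) (hl : ∀ i, l i ≠ 0) :
    (hypersurface f).IsSum (hypersurface g) fun i => hypersurface (l i) where
  carrier_eq := bendLocus_eq_of_tropFun_eq hf hg hl hs.tropFun_eq
  weight_eq w hw := facetWeight_eq_of_tropFun_eq hf hg hl hs.tropFun_eq <| by
    by_contra hc
    exact hw (if_neg hc)
  enrich_eq := hs.enrichment_eq

theorem exists_tropSplit_of_mem_iterate {L F : Set (HPoly n (TropExt H ℝ))} (hL : 0 ∉ L)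
    (hF : 0 ∉ F) (hg : g ∈ (colon L)^[k] F) :
    g ≠ 0 ∧ ∃ f ∈ F, ∃ l : Fin k → HPoly n (TropExt H ℝ), (∀ i, l i ∈ L) ∧ TropSplit f g l := by
  induction k generalizing F with
  | zero =>
    exact ⟨fun h => hF (h ▸ hg), g, hg, Fin.elim0, fun i => i.elim0, by simp, by simp⟩
  | succ k ih =>
    rw [Function.iterate_succ_apply] at hg
    have h0 : 0 ∉ colon L F := by
      rintro ⟨l, -, f, hf, hfF⟩
      exact ne_zero_of_mem_polyMul_left (fun h => hF (h ▸ hfF)) hf rfl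
    obtain ⟨hg0, h, hh, l, hl, hs⟩ := ih h0 hg
    obtain ⟨l₀, hl₀, f, hf, hfF⟩ := id hh
    refine ⟨hg0, f, hfF, Fin.cons l₀ l, ?_, hs.cons hf ?_ ?_⟩
    · exact Fin.cases hl₀ hl
    · exact fun h' => h0 (h' ▸ hh)
    · exact fun h' => hL (h' ▸ hl₀)

/-- Each product may be chosen arbitrarily, since the tropical function and the enrichment do not
depend on the choice. -/
theorem exists_tropSplit {L : Set (HPoly n (TropExt H ℝ))} (hL : 0 ∉ L) (hg : g ≠ 0)
    (l : Fin k → HPoly n (TropExt H ℝ)) (hl : ∀ i, l i ∈ L) :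
    ∃ f : HPoly n (TropExt H ℝ), f ≠ 0 ∧ TropSplit f g l ∧ g ∈ (colon L)^[k] {f} := by
  induction k with
  | zero => exact ⟨g, hg, ⟨by simp, by simp⟩, rfl⟩
  | succ k ih =>
    obtain ⟨h, hh, hs, hgh⟩ := ih (Fin.tail l) fun i => hl i.succ
    obtain ⟨f, hf⟩ := polyMul_nonempty h (l 0)
    have hl0 : l 0 ≠ 0 := fun e => hL (e ▸ hl 0)
    refine ⟨f, ne_zero_of_mem_polyMul hf hh hl0, ?_, ?_⟩
    · rw [← Fin.cons_self_tail l]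
      exact hs.cons hf hh hl0
    · rw [Function.iterate_succ_apply]
      refine colon_iterate_mono L k ?_ hgh
      rintro _ rfl
      exact ⟨l 0, hl 0, f, hf, rfl⟩

end Iterate

/-! ### The angular component -/

section AngularComponent

/-- This rests on properties of 𝕊. Summands of different valuation require `a ∈ a ⊞ b`, true for all
nonzero signs; cancellation leaves an arbitrary sign, which is allowed because `a ⊞ -a` is all of 𝕊.
-/
theorem TropExt.ac_mem_hadd {x y z : TropReal} (h : x ∈ Hyperfield.hadd y z) :
    x.ac ∈ Hyperfield.hadd y.ac z.ac := by
  change x ∈ TropExt.tadd y z at h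
  change y.ac = 0 ∧ x.ac = z.ac ∨ z.ac = 0 ∧ x.ac = y.ac ∨ y.ac ≠ 0 ∧ z.ac = y.ac ∧ x.ac = y.ac ∨
    y.ac ≠ 0 ∧ z.ac = -y.ac
  rcases y with _ | ⟨a, α⟩
  · exact Or.inl ⟨rfl, by rw [TropExt.mem_inf_left.1 h]⟩
  rcases z with _ | ⟨b, β⟩
  · exact Or.inr (Or.inl ⟨rfl, by rw [TropExt.mem_inf_right.1 h]⟩)
  have hab : (b : SignType) = a ∨ (b : SignType) = -a := by
    have key : ∀ a b : SignType, a ≠ 0 → b ≠ 0 → b = a ∨ b = -a := by decide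
    exact key a b a.ne_zero b.ne_zero
  refine Or.inr (Or.inr ?_)
  rcases hab with hab | hab
  · refine Or.inl ⟨a.ne_zero, hab, ?_⟩
    rcases lt_trichotomy α β with hl | rfl | hl
    · rw [(TropExt.mem_lt hl).1 h]
    · rcases TropExt.mem_eq.1 h with ⟨u, hu, rfl⟩ | ⟨h0, -⟩
      · change (u : SignType) = a
        rw [hab] at hu
        have key : ∀ a u : SignType, a ≠ 0 → (a = 0 ∧ u = a ∨ a = 0 ∧ u = a ∨
            a ≠ 0 ∧ a = a ∧ u = a ∨ a ≠ 0 ∧ a = -a) → u = a := by decide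
        exact key a u a.ne_zero hu
      · rw [Hyperfield.zero_mem_hadd_iff, hab] at h0
        have key : ∀ a : SignType, a ≠ 0 → a ≠ -a := by decide
        exact absurd h0 (key a a.ne_zero)
    · rw [(TropExt.mem_gt hl).1 h]
      exact hab
  · exact Or.inr ⟨a.ne_zero, hab⟩

theorem ac_mem_hsum {ι : Type*} {s : Finset ι} {F : ι → TropReal} {x : TropReal}
    (h : x ∈ hsum s F) : x.ac ∈ hsum s fun i => (F i).ac := by
  classical
  induction s using Finset.induction_on generalizing x with
  | empty =>
    rw [hsum_empty] at h ⊢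
    rw [h]
    rfl
  | insert a s ha ih =>
    obtain ⟨y, hy, hx⟩ := (mem_hsum_insert ha).1 h
    exact (mem_hsum_insert ha).2 ⟨y.ac, ih hy, TropExt.ac_mem_hadd hx⟩

theorem acPoly_apply (f : HPoly n TropReal) (m : Fin n →₀ ℕ) : acPoly f m = (f m).ac := rfl

theorem support_acPoly (f : HPoly n TropReal) : (acPoly f).support = f.support := by
  ext m
  rw [Finsupp.mem_support_iff, Finsupp.mem_support_iff, acPoly_apply]
  exact ⟨fun h h0 => h (by rw [h0]; rfl), TropExt.ac_ne_zero⟩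

theorem acPoly_mem_polyMul {f g l : HPoly n TropReal} (h : f ∈ polyMul g l) :
    acPoly f ∈ polyMul (acPoly g) (acPoly l) := fun m => by
  have := ac_mem_hsum (h m)
  simp only [TropExt.ac_mul] at this
  exact this

theorem IsPolyUnit.acPoly {u : HPoly n TropReal} (h : IsPolyUnit u) :
    IsPolyUnit (acPoly u) := by
  obtain ⟨v, hv⟩ := h
  refine ⟨TropicalMult.acPoly v, ?_⟩
  have := acPoly_mem_polyMul hv
  convert this using 1
  exact (Finsupp.mapRange_single (f := TropExt.ac) (hf := rfl) (a := 0) (b := (1 : TropReal))).symm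

theorem acPoly_mem_iterate {l : HPoly n SignType} {F : Set (HPoly n TropReal)}
    {F' : Set (HPoly n SignType)} (hF : ∀ g ∈ F, acPoly g ∈ F') {k : ℕ} {g : HPoly n TropReal}
    (hg : g ∈ (colon (acLifts l))^[k] F) : acPoly g ∈ (colon {l})^[k] F' := by
  induction k generalizing F F' with
  | zero => exact hF g hg
  | succ k ih =>
    rw [Function.iterate_succ_apply] at hg ⊢
    refine ih ?_ hg
    rintro h ⟨l', hl', f, hf, hfF⟩
    refine ⟨l, rfl, acPoly f, ?_, hF f hfF⟩
    rw [← (show acPoly l' = l from hl')]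
    exact acPoly_mem_polyMul hf

theorem pmult_le_mult (l f : HPoly n SignType) : pmult l f ≤ mult {l} {f} := by
  by_cases hu : ∃ u ∈ ({l} : Set (HPoly n SignType)), IsPolyUnit u
  · rw [mult, if_pos hu]
    exact le_top
  have hu' : ¬ ∃ u ∈ acLifts l, IsPolyUnit u := by
    rintro ⟨u, hul, h⟩
    exact hu ⟨acPoly u, hul, h.acPoly⟩
  rw [pmult, mult, if_neg hu', mult, if_neg hu]
  refine iSup₂_le fun k hk => ?_
  obtain ⟨g, hg⟩ := hk
  exact le_iSup₂ (f := fun (k : ℕ) (_ : ((colon {l})^[k] {f}).Nonempty) => (k : ℕ∞)) k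
    ⟨acPoly g, acPoly_mem_iterate (fun g hg => hg.1) hg⟩

end AngularComponent

/-! ### Linear forms -/

section LinearForm

variable {H : Type*} [Hyperfield H]

theorem eq_zero_of_bounded {v : Fin n → ℝ} {c : ℝ} (h : ∀ w, 0 ≤ c + v ⬝ᵥ w) : v = 0 := by
  by_contra hv
  have h0 : v ⬝ᵥ v ≠ 0 := fun e => hv (dotProduct_self_eq_zero.1 e)
  have := h (-((c + 1) / (v ⬝ᵥ v)) • v)
  rw [dotProduct_smul, smul_eq_mul, neg_mul, div_mul_cancel₀ _ h0] at this
  linarith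

/-- The tropical function of `1` is `0`, so each sum of a term of `u` and a term of `v` is an affine
function bounded below by `0`. Such a function is constant, which gives `p + q = 0`. -/
theorem support_subset_of_isPolyUnit {u : HPoly n (TropExt H ℝ)} (hu : IsPolyUnit u) :
    u.support ⊆ {0} := by
  obtain ⟨v, hv⟩ := hu
  have h1 : (Finsupp.single 0 1 : HPoly n (TropExt H ℝ)) ≠ 0 :=
    Finsupp.single_ne_zero.2 one_ne_zero
  have hu0 := ne_zero_of_mem_polyMul_left h1 hv
  have hv0 := ne_zero_of_mem_polyMul_right h1 hv
  intro p hp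
  obtain ⟨q, hq⟩ := Finsupp.support_nonempty_iff.2 hv0
  have h0 : ∀ w, 0 ≤ ((u p).val.untopD 0 + (v q).val.untopD 0) + realPt (p + q) ⬝ᵥ w := fun w => by
    have hs : (0 : Fin n →₀ ℕ) ∈ (Finsupp.single 0 1 : HPoly n (TropExt H ℝ)).support := by simp
    have hT : tropFun (Finsupp.single 0 1 : HPoly n (TropExt H ℝ)) w = 0 := by
      refine (finMin_eq (a := 0) hs fun b hb => ?_).trans ?_
      · rw [Finset.mem_singleton.1 (Finsupp.support_single_subset hb)]
      · rw [termVal_eq, Finsupp.single_eq_same]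
        have : realPt (0 : Fin n →₀ ℕ) = 0 := by ext i; simp [realPt]
        rw [this, zero_dotProduct, add_zero]
        rfl
    rw [untopD_add_eq u v p q w, sub_add_cancel, ← hT, tropFun_of_mem_polyMul hv hu0 hv0]
    exact add_le_add (tropFun_le hp w) (tropFun_le hq w)
  have h2 := eq_zero_of_bounded h0
  rw [Finset.mem_singleton]
  ext i
  have h3 := congrFun h2 i
  simp only [realPt, Finsupp.coe_add, Pi.add_apply, Pi.zero_apply, Nat.cast_eq_zero] at h3
  simp only [Finsupp.coe_zero, Pi.zero_apply]
  omega

theorem not_isPolyUnit_of_isLinearForm {l : HPoly n SignType} (hl : IsLinearForm l) :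
    ¬ ∃ u ∈ acLifts l, IsPolyUnit u := by
  rintro ⟨u, rfl, hu⟩
  have h1 := support_subset_of_isPolyUnit hu
  have h2 : totalDeg (acPoly u) ≤ 0 := by
    rw [totalDeg, support_acPoly]
    refine Finset.sup_le fun m hm => ?_
    rw [Finset.mem_singleton.1 (h1 hm)]
    simp
  rw [IsLinearForm] at hl
  omega

/-- A polynomial of degree one that is divisible by `x_i` can only be a multiple of `x_i`. -/
theorem exists_mem_support_apply_eq_zero {K : Type*} [Zero K] {l : HPoly n K}
    (hl : IsLinearForm l) (hm : ¬ IsMonomial l) (i : Fin n) : ∃ q ∈ l.support, q i = 0 := by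
  by_contra! h
  have hq : ∀ q ∈ l.support, q = Finsupp.single i 1 := fun q hq => by
    have hdeg : ∑ j, q j ≤ 1 := by
      rw [← (show totalDeg l = 1 from hl)]
      exact Finset.le_sup (f := fun m : Fin n →₀ ℕ => ∑ i, m i) hq
    have hqi := h q hq
    rw [← Finset.add_sum_erase _ _ (Finset.mem_univ i)] at hdeg
    have hz : ∑ j ∈ Finset.univ.erase i, q j = 0 := by omega
    ext j
    by_cases hji : j = i
    · rw [hji, Finsupp.single_eq_same]
      omega
    · rw [Finsupp.single_eq_of_ne hji]
      exact Finset.sum_eq_zero_iff.1 hz j (Finset.mem_erase.2 ⟨hji, Finset.mem_univ j⟩)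
  have hl0 : l ≠ 0 := by
    rintro rfl
    simp [IsLinearForm, totalDeg] at hl
  obtain ⟨q, hqs⟩ := Finsupp.support_nonempty_iff.2 hl0
  refine hm ⟨Finsupp.single i 1, l (Finsupp.single i 1), ?_, ?_⟩
  · rw [← hq q hqs]
    exact Finsupp.mem_support_iff.1 hqs
  · exact Finsupp.eq_single_iff.2 ⟨fun q hqs => Finset.mem_singleton.2 (hq q hqs), rfl⟩

theorem zero_notMem_acLifts {l : HPoly n SignType} (hl : l ≠ 0) :
    (0 : HPoly n TropReal) ∉ acLifts l := by
  rintro rfl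
  exact hl (Finsupp.ext fun m => rfl)

end LinearForm

/-! ### Multiplication by Laurent monomials -/

section Shift

variable {H : Type*} [Hyperfield H]

theorem exists_shift {g : HPoly n (TropExt H ℝ)} (hg : g ≠ 0) {s : Fin n → ℤ} (c : ℝ)
    (hs : ∀ p ∈ g.support, ∀ i, 0 ≤ (p i : ℤ) + s i) :
    ∃ g' : HPoly n (TropExt H ℝ), g' ≠ 0 ∧
      (∀ w, tropFun g' w = tropFun g w + ((fun i => (s i : ℝ)) ⬝ᵥ w + c)) ∧
      ∀ w ∉ bendLocus g, enrichment g' w = enrichment g w := by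
  classical
  -- Truncation to `ℕ` changes nothing on the support of `g`, by `hs`; elsewhere the value of `e` is
  -- irrelevant.
  set e : (Fin n →₀ ℕ) → (Fin n →₀ ℕ) := fun p =>
    Finsupp.equivFunOnFinite.symm fun i => ((p i : ℤ) + s i).toNat with he
  have hreal : ∀ p ∈ g.support, realPt (e p) = realPt p + fun i => (s i : ℝ) := fun p hp => by
    ext i
    have h1 : ((e p i : ℕ) : ℤ) = p i + s i := Int.toNat_of_nonneg (hs p hp i)
    have h2 : ((e p i : ℕ) : ℝ) = p i + s i := by exact_mod_cast h1
    exact h2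
  have hinj : ∀ p ∈ g.support, ∀ q ∈ g.support, e p = e q → p = q := fun p hp q hq h => by
    have := congrArg realPt h
    rw [hreal p hp, hreal q hq] at this
    exact realPt_injective (add_right_cancel this)
  set g' : HPoly n (TropExt H ℝ) := Finsupp.onFinset (g.support.image e)
    (fun m => if h : ∃ p ∈ g.support, e p = m then g h.choose * .mono 1 c else 0)
    (fun m hm => by
      by_contra hc
      refine hm (dif_neg fun h => hc ?_)
      obtain ⟨p, hp, hpm⟩ := h
      exact Finset.mem_image.2 ⟨p, hp, hpm⟩) with hg'
  have hcoef : ∀ p ∈ g.support, g' (e p) = g p * .mono 1 c := fun p hp => by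
    have hex : ∃ q ∈ g.support, e q = e p := ⟨p, hp, rfl⟩
    change (if h : ∃ q ∈ g.support, e q = e p then g h.choose * .mono 1 c else 0) = _
    rw [dif_pos hex, hinj _ hex.choose_spec.1 p hp hex.choose_spec.2]
  have hsupp : ∀ m, m ∈ g'.support ↔ ∃ p ∈ g.support, e p = m := fun m => by
    constructor
    · intro hm
      by_contra hc
      exact Finsupp.mem_support_iff.1 hm (dif_neg hc)
    · rintro ⟨p, hp, rfl⟩
      rw [Finsupp.mem_support_iff, hcoef p hp]
      exact mul_ne_zero (Finsupp.mem_support_iff.1 hp) nofun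
  have hterm : ∀ p ∈ g.support, ∀ w,
      termVal g' (e p) w = termVal g p w + ((fun i => (s i : ℝ)) ⬝ᵥ w + c) := fun p hp w => by
    have hv := TropExt.val_mul_eq_coe (Finsupp.mem_support_iff.1 hp)
      (y := (.mono 1 c : TropExt H ℝ)) nofun
    rw [termVal_eq, termVal_eq, hreal p hp, hcoef p hp, hv, add_dotProduct, WithTop.untopD_coe]
    change (g p).val.untopD 0 + c + _ = _
    ring
  have hT : ∀ w, tropFun g' w = tropFun g w + ((fun i => (s i : ℝ)) ⬝ᵥ w + c) := fun w => by
    obtain ⟨p, hp, hpw⟩ := exists_tropFun_eq hg w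
    rw [hpw, ← hterm p hp]
    refine finMin_eq (φ := fun m => termVal g' m w) ((hsupp _).2 ⟨p, hp, rfl⟩) fun m hm => ?_
    obtain ⟨q, hq, rfl⟩ := (hsupp m).1 hm
    rw [hterm p hp, hterm q hq, ← hpw]
    gcongr
    exact tropFun_le hq w
  obtain ⟨p, hp⟩ := Finsupp.support_nonempty_iff.2 hg
  refine ⟨g', Finsupp.support_nonempty_iff.1 ⟨e p, (hsupp _).2 ⟨p, hp, rfl⟩⟩, hT, fun w hw => ?_⟩
  obtain ⟨q, hq⟩ := (notMem_bendLocus_iff_exists hg).1 hw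
  obtain ⟨hqs, hqv⟩ := mem_initSupp.1 (hq ▸ Finset.mem_singleton_self q : q ∈ initSupp g w)
  have hi : initSupp g' w = {e q} := by
    refine Finset.eq_singleton_iff_unique_mem.2 ⟨mem_initSupp.2
      ⟨(hsupp _).2 ⟨q, hqs, rfl⟩, ?_⟩, fun m hm => ?_⟩
    · rw [hterm q hqs, hT, hqv]
    · obtain ⟨hms, hmv⟩ := mem_initSupp.1 hm
      obtain ⟨r, hr, rfl⟩ := (hsupp m).1 hms
      rw [hterm r hr, hT] at hmv
      have : r ∈ initSupp g w := mem_initSupp.2 ⟨hr, add_right_cancel hmv⟩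
      rw [hq, Finset.mem_singleton] at this
      rw [this]
  rw [enrichment_eq_ac hq, enrichment_eq_ac hi, hcoef q hqs, TropExt.ac_mul]
  exact mul_one _

end Shift

/-! ### Membership in a product -/

section Membership

variable {H : Type*} [Hyperfield H] {f g l : HPoly n (TropExt H ℝ)}

/-- Otherwise a linear functional separates `p + q` strictly from the Newton polytope. Far out along
the corresponding ray, the function of `f` grows faster than the term of `g` plus the term of `l`
that bound it from above. -/
theorem realPt_add_mem_newton (hf : f ≠ 0) (h : ∀ w, tropFun f w = tropFun g w + tropFun l w)
    {p q : Fin n →₀ ℕ} (hp : p ∈ g.support) (hq : q ∈ l.support) :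
    realPt (p + q) ∈ newton f := by
  by_contra hn
  have hcl : IsClosed (newton f) :=
    ((Finset.finite_toSet f.support).image realPt).isClosed_convexHull ℝ
  obtain ⟨φ, r, hφ1, hφ2⟩ := geometric_hahn_banach_point_closed (convex_convexHull ℝ _) hcl hn
  set v : Fin n → ℝ := fun i => φ (Pi.single i 1) with hv
  have hφ : ∀ x, φ x = x ⬝ᵥ v := fun x => by
    have := LinearMap.pi_apply_eq_sum_univ (φ : (Fin n → ℝ) →ₗ[ℝ] ℝ) x
    simp only [smul_eq_mul] at this
    refine this.trans (Finset.sum_congr rfl fun i _ => ?_)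
    have hs : (fun j => if i = j then (1 : ℝ) else 0) = Pi.single i 1 := by
      ext j
      simp [Pi.single_apply, eq_comm]
    rw [hs]
    rfl
  set B := finMin f.support fun m => (f m).val.untopD 0 with hB
  set C := (g p).val.untopD 0 + (l q).val.untopD 0 with hC
  have key : ∀ t : ℝ, 0 ≤ t → B + t * r ≤ C + t * φ (realPt (p + q)) := fun t ht => by
    have h1 : tropFun f (t • v) ≤ C + t * φ (realPt (p + q)) := by
      rw [h, hC, untopD_add_eq g l p q (t • v), hφ, ← smul_eq_mul t, ← dotProduct_smul,
        sub_add_cancel]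
      exact add_le_add (tropFun_le hp _) (tropFun_le hq _)
    refine le_trans ?_ h1
    obtain ⟨m, hm, e⟩ := exists_tropFun_eq hf (t • v)
    rw [e, termVal_eq, dotProduct_smul, ← hφ, smul_eq_mul]
    have h2 : B ≤ (f m).val.untopD 0 := finMin_le (φ := fun m => (f m).val.untopD 0) hm
    have h3 := (hφ2 _ (subset_convexHull ℝ _ ⟨m, hm, rfl⟩)).le
    gcongr
  have hd : 0 < r - φ (realPt (p + q)) := sub_pos.2 hφ1
  have h4 := key ((|C - B| + 1) / (r - φ (realPt (p + q)))) (by positivity)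
  have h5 : (|C - B| + 1) / (r - φ (realPt (p + q))) * (r - φ (realPt (p + q))) = |C - B| + 1 :=
    div_mul_cancel₀ _ hd.ne'
  have h6 := le_abs_self (C - B)
  linarith

theorem TropExt.ext_val_ac {x y : TropExt H ℝ} (hx : x ≠ 0) (hy : y ≠ 0)
    (hv : x.val.untopD 0 = y.val.untopD 0) (ha : x.ac = y.ac) : x = y := by
  cases x with
  | inf => exact absurd rfl hx
  | mono a α =>
    cases y with
    | inf => exact absurd rfl hy
    | mono b β => exact congrArg₂ _ (Units.ext ha) hv

/-- A strictly convex dense polynomial belongs to `g · l` as soon as its tropical function and its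
enrichment are those of a product of `g` and `l`. -/
theorem mem_polyMul_of_tropFun_eq (hf : f ≠ 0) (hg : g ≠ 0) (hl : l ≠ 0) (hc : StrictlyConvex f)
    (hd : IsDense f) (h : ∀ w, tropFun f w = tropFun g w + tropFun l w)
    (he : ∀ w ∉ bendLocus f, enrichment f w = enrichment g w * enrichment l w) :
    f ∈ polyMul g l := by
  intro m
  by_cases hm : m ∈ f.support
  · obtain ⟨U, hUo, hUn, hU⟩ := hc m hm
    -- Strict convexity provides an open set on which `m` is minimal; a generic point of it has
    -- unique minima for `g` and `l` too.
    obtain ⟨w, hwU, hwg, hwl⟩ := (dense_compl_bendLocus_inter (l := l) hg).inter_open_nonempty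
      U hUo hUn
    have hwf := (notMem_bendLocus_iff_of_tropFun_eq_add hf hg hl h w).2 ⟨hwg, hwl⟩
    obtain ⟨p, hp⟩ := (notMem_bendLocus_iff_exists hg).1 hwg
    obtain ⟨q, hq⟩ := (notMem_bendLocus_iff_exists hl).1 hwl
    obtain ⟨m', hm'⟩ := (notMem_bendLocus_iff_exists hf).1 hwf
    have hmw := hU w hwU
    rw [hm', Finset.mem_singleton] at hmw
    subst hmw
    have hmv := (mem_initSupp.1 (hm' ▸ Finset.mem_singleton_self m : m ∈ initSupp f w)).2
    obtain ⟨hps, hpv⟩ := mem_initSupp.1 (hp ▸ Finset.mem_singleton_self p : p ∈ initSupp g w)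
    obtain ⟨hqs, hqv⟩ := mem_initSupp.1 (hq ▸ Finset.mem_singleton_self q : q ∈ initSupp l w)
    have hmpq : m = p + q := by
      -- The three initial supports at `w` are singletons, and additivity of their support functions
      -- identifies `m` with `p + q`.
      refine realPt_injective (sub_eq_zero.1 (eq_zero_of_bounded (c := 0) fun y => ?_))
      have := suppMin_initSupp_eq (ι := Unit) (l := fun _ => l) hf hg (fun _ => hl)
        (fun w => by rw [Fintype.sum_unique]; exact h w) w y
      rw [Fintype.sum_unique, hm', hp, hq, suppMin_singleton, suppMin_singleton,
        suppMin_singleton, ← add_dotProduct, ← realPt_add] at this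
      rw [sub_dotProduct, this]
      simp
    have hps' := Finsupp.mem_support_iff.1 hps
    have hqs' := Finsupp.mem_support_iff.1 hqs
    have hfm : f m = g p * l q := by
      refine TropExt.ext_val_ac (Finsupp.mem_support_iff.1 hm) (mul_ne_zero hps' hqs') ?_ ?_
      · rw [TropExt.val_mul_eq_coe hps' hqs', WithTop.untopD_coe, untopD_add_eq g l p q w, hpv,
          hqv, ← h, ← hmv, termVal_eq, ← hmpq]
        ring
      · rw [TropExt.ac_mul, ← enrichment_eq_ac hm', ← enrichment_eq_ac hp, ← enrichment_eq_ac hq]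
        exact he w hwf
    rw [hfm, hmpq, hsum_eq_of_initSupp_eq_singleton hp hq]
    rfl
  · rw [Finsupp.notMem_support_iff.1 hm, hsum_eq_zero]
    · rfl
    -- A nonzero product would place `m` in the Newton polytope, and by density in the support. So
    -- every term of the hypersum is zero.
    · intro r hr
      by_contra hne
      have hr' := Finset.HasAntidiagonal.mem_antidiagonal.1 hr
      have h1 : realPt m ∈ newton f := hr' ▸ realPt_add_mem_newton hf h
        (Finsupp.mem_support_iff.2 (left_ne_zero_of_mul hne))
        (Finsupp.mem_support_iff.2 (right_ne_zero_of_mul hne))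
      have h2 : realPt m ∈ realPt '' (f.support : Set (Fin n →₀ ℕ)) := by
        rw [hd]
        exact ⟨h1, fun i => ⟨m i, by simp [realPt]⟩⟩
      obtain ⟨m', hm', e⟩ := h2
      exact hm (realPt_injective e ▸ hm')

end Membership

/-! ### The geometric multiplicity -/

section Geometric

variable {H : Type*} [Hyperfield H] {f g : HPoly n (TropExt H ℝ)}

theorem maxLength_eq_zero_iff {M : Finset (Fin n →₀ ℕ)} : maxLength M = 0 ↔ M.card ≤ 1 := by
  rw [maxLength, ← Nat.bot_eq_zero, Finset.sup_eq_bot_iff, Finset.card_le_one]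
  simp only [Finset.sup_eq_bot_iff]
  simp only [Nat.bot_eq_zero, latticeLength_eq_zero_iff]

/-- If the hypersurface of `f` is the sum of those of `g` and of `l i`, then, up to a Laurent
monomial, the tropical function of `f` is that of a product of `g` and the `l i`. -/
theorem exists_tropFun_eq_of_isSum (hf : f ≠ 0) (hg : g ≠ 0) {k : ℕ}
    {l : Fin k → HPoly n (TropExt H ℝ)} (hl : ∀ i, l i ≠ 0)
    (h : (hypersurface f).IsSum (hypersurface g) fun i => hypersurface (l i)) :
    ∃ (s : Fin n → ℤ) (c : ℝ), ∀ w, tropFun f w =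
      tropFun g w + ∑ i, tropFun (l i) w + ((fun i => (s i : ℝ)) ⬝ᵥ w + c) := by
  -- `P` is any member of the product of `g` and all `l i`; its hypersurface has the same bend locus
  -- and facet weights as that of `f`.
  obtain ⟨P, hP, hs, -⟩ := exists_tropSplit (L := {0}ᶜ) (by simp) hg l hl
  have hb : bendLocus f = bendLocus P :=
    h.carrier_eq.trans (bendLocus_eq_of_tropFun_eq hP hg hl hs.tropFun_eq).symm
  obtain ⟨s, c, hsc⟩ := exists_tropFun_eq_add_affine hf hP hb fun w hcf hcP => by
    -- `IsSum` relates the weights only where that of `V` is nonzero. At a point with collinear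
    -- initial support, weight `0` means that the point is off the common bend locus.
    by_cases h0 : facetWeight f w = 0
    · have hw : w ∉ bendLocus f := by
        rw [facetWeight_of_collinear hcf, maxLength_eq_zero_iff] at h0
        exact notMem_bendLocus_iff.2 h0
      rw [hb, notMem_bendLocus_iff] at hw
      rw [h0, facetWeight_of_collinear hcP, maxLength_eq_zero_iff.2 hw]
    · rw [facetWeight_eq_of_tropFun_eq hP hg hl hs.tropFun_eq hcP]
      exact h.weight_eq w h0
  exact ⟨s, c, fun w => by rw [hsc, hs.tropFun_eq]⟩

/-- Along the positive `i`-th axis the function of `f` is bounded below, having exponents in `ℕ`.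
The terms of the `l j` with `q i = 0` are constant there, so the term of `p` bounds it above by a
function of slope `p i + s i`, which cannot be negative. -/
theorem zero_le_add_of_tropFun_eq (hf : f ≠ 0) {k : ℕ}
    {l : Fin k → HPoly n (TropExt H ℝ)} {s : Fin n → ℤ} {c : ℝ}
    (h : ∀ w, tropFun f w =
      tropFun g w + ∑ i, tropFun (l i) w + ((fun i => (s i : ℝ)) ⬝ᵥ w + c))
    {i : Fin n} (hl : ∀ j, ∃ q ∈ (l j).support, q i = 0) {p : Fin n →₀ ℕ} (hp : p ∈ g.support) :
    0 ≤ (p i : ℤ) + s i := by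
  by_contra! hlt
  choose q hq hqi using hl
  have hdot : ∀ (m : Fin n →₀ ℕ) (t : ℝ), realPt m ⬝ᵥ (t • Pi.single i 1) = t * m i :=
    fun m t => by rw [dotProduct_smul, dotProduct_single, mul_one, smul_eq_mul]; rfl
  set B := finMin f.support fun m => (f m).val.untopD 0 with hB
  set C := (g p).val.untopD 0 + ∑ j, (l j (q j)).val.untopD 0 + c with hC
  set t := |C - B| + 1 with ht
  have ht0 : 0 ≤ t := by positivity
  have h1 : B ≤ tropFun f (t • Pi.single i 1) := by
    obtain ⟨m, hm, e⟩ := exists_tropFun_eq hf (t • Pi.single i 1)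
    rw [e, termVal_eq, hdot]
    have h2 : B ≤ (f m).val.untopD 0 := finMin_le (φ := fun m => (f m).val.untopD 0) hm
    have h3 : 0 ≤ t * m i := by positivity
    linarith
  have h2 := tropFun_le hp (t • Pi.single i 1)
  have h3 : ∑ j, tropFun (l j) (t • Pi.single i 1) ≤ ∑ j, (l j (q j)).val.untopD 0 :=
    Finset.sum_le_sum fun j _ => by
      refine (tropFun_le (hq j) _).trans ?_
      rw [termVal_eq, hdot, hqi]
      simp
  rw [termVal_eq, hdot] at h2
  rw [h, dotProduct_smul, dotProduct_single, mul_one, smul_eq_mul] at h1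
  have h4 : (p i : ℝ) + s i ≤ -1 := by exact_mod_cast Int.le_sub_one_of_lt hlt
  have h5 : t * ((p i : ℝ) + s i) ≤ t * (-1) := mul_le_mul_of_nonneg_left h4 ht0
  have h6 := le_abs_self (C - B)
  linarith

theorem isDense_of_acPoly {f : HPoly n TropReal} (h : IsDense (acPoly f)) : IsDense f := by
  rw [IsDense, newton, support_acPoly] at h
  exact h

/-- Only the outermost factorization has to produce the given `f`; the intermediate polynomials need
be neither strictly convex nor dense. So all factors except `l 0` are multiplied with arbitrary
choices. -/
theorem iterate_nonempty_of_isSum {f₀ l₀ : HPoly n SignType} (hf₀ : f₀ ≠ 0) (hd : IsDense f₀)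
    (hl₀ : IsLinearForm l₀) (hm : ¬ IsMonomial l₀) {f : HPoly n TropReal}
    (hf : f ∈ convexLifts f₀) {k : ℕ} {l : Fin k → HPoly n TropReal} (hl : ∀ i, l i ∈ acLifts l₀)
    {W : EnrichedComplex n SignType} (hW : W.IsTropicalHypersurface)
    (h : (hypersurface f).IsSum W fun i => hypersurface (l i)) :
    ((colon (acLifts l₀))^[k] (convexLifts f₀)).Nonempty := by
  obtain _ | k := k
  · exact ⟨f, hf⟩
  obtain ⟨g, hg, rfl⟩ := hW.exists_eq_hypersurface
  have hl₀0 : l₀ ≠ 0 := by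
    rintro rfl
    simp [IsLinearForm, totalDeg] at hl₀
  have hL := zero_notMem_acLifts hl₀0
  have hl0 : ∀ i, l i ≠ 0 := fun i e => hL (e ▸ hl i)
  obtain ⟨⟨hfa, hfc⟩, hf'⟩ := And.intro hf hf
  have hf0 : f ≠ 0 := by
    rintro rfl
    exact zero_notMem_acLifts hf₀ hfa
  have hfd : IsDense f := isDense_of_acPoly (by rwa [show acPoly f = f₀ from hfa])
  obtain ⟨s, c, hT⟩ := exists_tropFun_eq_of_isSum hf0 hg hl0 h
  have hs : ∀ p ∈ g.support, ∀ i, 0 ≤ (p i : ℤ) + s i := fun p hp i =>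
    zero_le_add_of_tropFun_eq hf0 hT (fun j => by
      rw [← support_acPoly, show acPoly (l j) = l₀ from hl j]
      exact exists_mem_support_apply_eq_zero hl₀ hm i) hp
  obtain ⟨g', hg', hT', he'⟩ := exists_shift hg c hs
  obtain ⟨P, hP, hPs, hgP⟩ := exists_tropSplit hL hg' (Fin.tail l) fun i => hl i.succ
  have hTP : ∀ w, tropFun f w = tropFun P w + tropFun (l 0) w := fun w => by
    rw [hT, hPs.tropFun_eq, hT', Fin.sum_univ_succ]
    simp only [Fin.tail]
    ring
  have hfP : f ∈ polyMul P (l 0) := by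
    refine mem_polyMul_of_tropFun_eq hf0 hP (hl0 0) hfc hfd hTP fun w hw => ?_
    -- The enrichment of the shifted polynomial `g'` is known off the bend locus of `g` only, which
    -- is contained in that of `f`.
    have hwg : w ∉ bendLocus g := fun hwg => hw (by
      change w ∈ (hypersurface f).carrier
      rw [h.carrier_eq]
      exact Or.inl hwg)
    have hwP := ((notMem_bendLocus_iff_of_tropFun_eq_add hf0 hP (hl0 0) hTP w).1 hw).1
    have h1 : enrichment f w = enrichment g w * ∏ i, enrichment (l i) w := h.enrich_eq w hw
    rw [h1, hPs.enrichment_eq w hwP, he' w hwg, Fin.prod_univ_succ, mul_assoc,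
      mul_comm (enrichment (l 0) w)]
    rfl
  refine ⟨g', ?_⟩
  rw [Function.iterate_succ_apply]
  refine colon_iterate_mono _ k ?_ hgP
  rintro _ rfl
  exact ⟨l 0, hl 0, f, hfP, hf⟩

theorem pmult_eq_gmultSet {f l : HPoly n SignType} (hl : IsLinearForm l) (hf : f ≠ 0)
    (hd : IsDense f) (hm : ¬ IsMonomial l) :
    pmult l f = gmultSet (acLifts l) (convexLifts f) := by
  rw [pmult, mult, if_neg (not_isPolyUnit_of_isLinearForm hl)]
  apply le_antisymm
  · refine iSup₂_le fun k hk => ?_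
    obtain ⟨g, hg⟩ := hk
    have hl0 : l ≠ 0 := by
      rintro rfl
      simp [IsLinearForm, totalDeg] at hl
    have hL := zero_notMem_acLifts hl0
    have hF : 0 ∉ convexLifts f := fun h => zero_notMem_acLifts hf h.1
    obtain ⟨hg0, h, hh, l', hl', hs⟩ := exists_tropSplit_of_mem_iterate hL hF hg
    have h1 : (k : ℕ∞) ≤ gmult (acLifts l) (hypersurface h) :=
      le_iSup₂ (f := fun (k : ℕ) (_ : ∃ (l' : Fin k → HPoly n TropReal)
        (W : EnrichedComplex n SignType), (∀ i, l' i ∈ acLifts l) ∧ W.IsTropicalHypersurface ∧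
          (hypersurface h).IsSum W fun i => hypersurface (l' i)) => (k : ℕ∞)) k
        ⟨l', hypersurface g, hl', isTropicalHypersurface_hypersurface hg0,
          hs.isSum (fun e => hF (e ▸ hh)) hg0 fun i e => hL (e ▸ hl' i)⟩
    exact h1.trans (le_iSup₂ (f := fun h (_ : h ∈ convexLifts f) =>
      gmult (acLifts l) (hypersurface h)) h hh)
  · refine iSup₂_le fun h hh => iSup₂_le fun k hk => ?_
    obtain ⟨l', W, hl', hW, hs⟩ := hk
    exact le_iSup₂ (f := fun (k : ℕ)
      (_ : ((colon (acLifts l))^[k] (convexLifts f)).Nonempty) => (k : ℕ∞)) k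
      (iterate_nonempty_of_isSum hf hd hl hm hh hl' hW hs)

end Geometric

end TropicalMult

theorem mainTheorem8 (n : ℕ) (f l : TropicalMult.HPoly n SignType)
    (hl : TropicalMult.IsLinearForm l) :
    TropicalMult.pmult l f ≤ TropicalMult.mult {l} {f} ∧
    (f ≠ 0 → TropicalMult.IsDense f → ¬ TropicalMult.IsMonomial l →
      TropicalMult.pmult l f =
        TropicalMult.gmultSet (TropicalMult.acLifts l) (TropicalMult.convexLifts f)) :=
  ⟨TropicalMult.pmult_le_mult l f,
    fun hf hd hm => TropicalMult.pmult_eq_gmultSet hl hf hd hm⟩
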